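/- Let $1\le k\le n$ be integers and let $\mathbb S^n\subset\mathbb R^{n+1}$ be the unit sphere with its round metric, gradient $\nabla$ and Hessian $\nabla^2$. For a symmetric endomorphism $b$ of a tangent space of $\mathbb S^n$ let $\sigma_k(b)$ be the $k$-th elementary symmetric function of its eigenvalues; a smooth function $h:\mathbb S^n\to\mathbb R$ is called strictly convex if $\sigma_i(\nabla^2h+hI)>0$ on $\mathbb S^n$ for all $1\le i\le n$ (that is, if $\nabla^2 h+hI$ is positive definite everywhere), and even if $h(-x)=h(x)$. Put $\|f\|_{C^2(\mathbb S^n)}=\sup|f|+\sup|\nabla f|+\sup|\nabla^2f|$. Let $\gamma>0$, $\delta>0$, $m>0$ and $A\in\mathbb R$. Then there is a constant $C>0$, depending only on $n,k,\gamma,\delta,m,A$, such that the following holds. Let $1<p<q\le k+1$ be real numbers with $q-p\ge\delta$ and $\gamma<2(p-1)/k$, let $f:\mathbb S^n\to\mathbb R$ be of class $C^2$ with $\min_{\mathbb S^n} f\ge m$ and $\|f\|_{C^2(\mathbb S^n)}\le A$, and let $h$ be an even, smooth, strictly convex solution of $$\sigma_k(\nabla^2h+hI)=f\,h^{p-1}\,(h^2+|\nabla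 h|^2)^{\frac{k+1-q}{2}}\quad\text{on }\mathbb S^n .$$ Then $$\frac1C\le h\le C\qquad\text{and}\qquad |\nabla h|\le C\qquad\text{on }\mathbb S^n .$$ In particular, for fixed $p,q$ (and any fixed $\gamma\in(0,2(p-1)/k)$), $C$ depends only on $n,k,\gamma,q-p,\min f$ and $\|f\|_{C^2}$. -/

import Mathlib

open scoped Manifold ContDiff RealInnerProductSpace

noncomputable section

namespace ChristoffelMinkowski

/-- The Euclidean space `ℝⁿ⁺¹`. -/
abbrev Euc (n : ℕ) : Type := EuclideanSpace ℝ (Fin (n + 1))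

/-- The unit sphere `𝕊ⁿ` of `ℝⁿ⁺¹`. -/
abbrev Sph (n : ℕ) : Type := Metric.sphere (0 : Euc n) 1

/-- The tangent space of `𝕊ⁿ` at `x`, as the subspace `x^⊥` of `ℝⁿ⁺¹`, with the induced (round)
inner product. -/
abbrev Tan {n : ℕ} (x : Sph n) : Submodule ℝ (Euc n) := (ℝ ∙ (x : Euc n))ᗮ

/-- The extension `y ↦ h (y / |y|)` of a function on the sphere, constant along open rays
(with the irrelevant value `0` at the origin). -/
def radExt {n : ℕ} (h : Sph n → ℝ) (y : Euc n) : ℝ :=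
  Function.extend (Subtype.val : Sph n → Euc n) h 0 (‖y‖⁻¹ • y)

/-- `radExt h` does extend `h`. -/
theorem radExt_coe {n : ℕ} (h : Sph n → ℝ) (x : Sph n) : radExt h (x : Euc n) = h x := by
  have hx : ‖(x : Euc n)‖ = 1 := norm_eq_of_mem_sphere x
  unfold radExt
  rw [hx, inv_one, one_smul]
  exact Subtype.val_injective.extend_apply h 0 x

/-- The spherical gradient `∇h (x)`, as a vector of `ℝⁿ⁺¹`. The radial derivative of `radExt h`
vanishes, so its Euclidean gradient at a point `x` of the sphere is tangent to the sphere and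
represents the differential of `h` at `x`. -/
def sphGrad {n : ℕ} (h : Sph n → ℝ) (x : Sph n) : Euc n :=
  gradient (radExt h) (x : Euc n)

/-- The spherical Hessian `∇²h (x)` as an endomorphism of the tangent space: `u ↦ ∇_u ∇h`, where the
Levi-Civita connection of the sphere is the tangential part of the Euclidean derivative.
(On the sphere, `gradient (radExt h)` is the field `∇h`, and the derivative in a tangent
direction only involves its values on the sphere.) -/
def sphHess {n : ℕ} (h : Sph n → ℝ) (x : Sph n) : Tan x →L[ℝ] Tan x :=
  (Tan x).orthogonalProjectionOnto ∘L
    (fderiv ℝ (gradient (radExt h)) (x : Euc n) ∘L (Tan x).subtypeL)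

/-- `b[h] = ∇²h + h I` at `x`. -/
def radiiOp {n : ℕ} (h : Sph n → ℝ) (x : Sph n) : Tan x →L[ℝ] Tan x :=
  sphHess h x + h x • ContinuousLinearMap.id ℝ (Tan x)

/-- `σ_k (A)`: the `k`-th elementary symmetric function of the (real) eigenvalues of `A`, counted with
multiplicity. It is only used for self-adjoint `A`, where all eigenvalues are real. -/
def sigma {V : Type*} [NormedAddCommGroup V] [InnerProductSpace ℝ V] [FiniteDimensional ℝ V]
    (k : ℕ) (A : V →L[ℝ] V) : ℝ :=
  (LinearMap.charpoly (A : V →ₗ[ℝ] V)).roots.esymm k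

/-- Strict (spherical) convexity: the eigenvalues of `∇²h + h I` lie in `Γ_n` at every point. -/
def StrictlyConvex {n : ℕ} (h : Sph n → ℝ) : Prop :=
  ∀ x : Sph n, ∀ i : ℕ, 1 ≤ i → i ≤ n → 0 < sigma i (radiiOp h x)

/-- The equation `σ_k (∇²h + h I) = f h^(p-1) (h² + |∇h|²)^((k+1-q)/2)` on `𝕊ⁿ`. -/
def IsSolution {n : ℕ} (k : ℕ) (p q : ℝ) (f h : Sph n → ℝ) : Prop :=
  ∀ x : Sph n, sigma k (radiiOp h x) =
    f x * h x ^ (p - 1) * (h x ^ 2 + ‖sphGrad h x‖ ^ 2) ^ (((k : ℝ) + 1 - q) / 2)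

/-- The norm `‖f‖_{C²(𝕊ⁿ)} = sup |f| + sup |∇f| + sup |∇²f|` of a `C²` function on the sphere. -/
def c2Norm {n : ℕ} (f : Sph n → ℝ) : ℝ :=
  (⨆ x, |f x|) + (⨆ x, ‖sphGrad f x‖) + ⨆ x, ‖sphHess f x‖

end ChristoffelMinkowski

end

/-!
The equation is studied through the extension `H y = |y| h (y / |y|)`, which is homogeneous of degree
one. Its Hessian at a point `x` of the sphere annihilates `x` and equals `∇²h + h I` on `x^⊥`, so it
is positive definite there (`tangentiallyPosDef_homExt`), and `σ_k (∇²h + h I)` is a coefficient of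
the characteristic polynomial of a symmetric matrix of fixed size (`matSigma_hess_eq`). Integrating
the Hessian along segments gives the supporting hyperplane inequality
(`SmoothHomogeneous.fderiv_apply_lt`). Together with evenness it yields `h > 0`, and
`H y ≥ M ⟨y, v⟩` when `v` is a maximum point of `h` and `M = h v`.

The core is a gradient estimate `|∇h| ≤ C M ^ (1 - α) h ^ α` with `α = γ / 4`. Let `x` maximize
`|∇h| / h ^ α`, let `e` be the direction of `∇h x`, and put `s = |∇h x|`. The second derivative test
bounds the third derivatives `D³H (e, a, a)` by `α (s / h) D²H (a, a)` as soon as `s / h` is large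
(`SmoothHomogeneous.third_fderiv_le_of_isMax_grad`). As the derivative of `σ_k` at a positive
semidefinite diagonal matrix is diagonal, nonnegative and homogeneous, `log σ_k` grows in direction
`e` at most at the rate `α k s / h`. The right hand side of the equation grows at least at the rate
`(p - 1) s / h - |∇ log f|`, because `h² + |∇h|²` is nondecreasing in that direction by convexity.
Since `2 α k < p - 1`, this bounds `s / h` (`norm_sphGrad_le_of_isMax`).

By this estimate `h ^ (1 - α)` is Lipschitz with constant of order `M ^ (1 - α)`. Near a minimum point
`h` would therefore grow slower than linearly if the minimum were much smaller than `M`, which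
contradicts the lower bound `M ⟨y, v⟩`; hence `min h ≥ c max h` (`mul_max_le_min`). Finally, the
equation at a maximum point bounds `max h` from below, and at a minimum point it bounds `min h` from
above (`le_choose_mul_of_isMax`, `choose_mul_le_of_isMin`).
-/

namespace ChristoffelMinkowski

/-! ### Elementary symmetric functions of matrices and self-adjoint operators -/

section Matrices

open Polynomial

variable {ι : Type*} [Fintype ι] [DecidableEq ι]

theorem hasDerivAt_mvPolynomial_eval {τ : Type*} [Fintype τ] (q : MvPolynomial τ ℝ)
    {c : ℝ → τ → ℝ} {c' : τ → ℝ} {s : ℝ} (hc : ∀ i, HasDerivAt (fun t => c t i) (c' i) s) :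
    HasDerivAt (fun t => MvPolynomial.eval (c t) q)
      (∑ i, MvPolynomial.eval (c s) (MvPolynomial.pderiv i q) * c' i) s := by
  classical
  induction q using MvPolynomial.induction_on with
  | C a => simpa using hasDerivAt_const s a
  | add p q hp hq =>
    simp only [map_add, add_mul, Finset.sum_add_distrib]
    exact hp.add hq
  | mul_X p i hp =>
    have h := hp.mul (hc i)
    simp only [map_mul, MvPolynomial.eval_X]
    refine h.congr_deriv ?_
    simp only [Derivation.leibniz, MvPolynomial.pderiv_X, smul_eq_mul, map_add, map_mul,
      MvPolynomial.eval_X, add_mul, Finset.sum_add_distrib, Finset.sum_mul]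
    rw [add_comm]
    congr 1
    · rw [Finset.sum_eq_single i]
      · simp
      · intro b _ hb
        simp [hb.symm]
      · simp
    · exact Finset.sum_congr rfl fun j _ => by ring

/-- The `k`-th elementary symmetric function of the eigenvalues of a square matrix, as a signed
coefficient of its characteristic polynomial (for `k` at most the size of the matrix). -/
noncomputable def matSigma (k : ℕ) (M : Matrix ι ι ℝ) : ℝ :=
  (-1) ^ k * M.charpoly.coeff (Fintype.card ι - k)

theorem matSigma_eq_eval (k : ℕ) (M : Matrix ι ι ℝ) :
    matSigma k M = MvPolynomial.eval (fun ij : ι × ι => M ij.1 ij.2)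
      (MvPolynomial.C ((-1) ^ k) *
        (Matrix.charpoly.univ ℝ ι).coeff (Fintype.card ι - k)) := by
  have h := Matrix.charpoly.univ_coeff_eval₂Hom ι (RingHom.id ℝ)
    (fun ij : ι × ι => M ij.1 ij.2) (Fintype.card ι - k)
  rw [map_mul, MvPolynomial.eval_C, matSigma]
  congr 1
  exact h.symm

theorem matSigma_diagonal {k : ℕ} (hk : k ≤ Fintype.card ι) (d : ι → ℝ) :
    matSigma k (Matrix.diagonal d) =
      ∑ t ∈ (Finset.univ : Finset ι).powersetCard k, ∏ i ∈ t, d i := by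
  have h := (Finset.univ : Finset ι).prod_X_add_C_coeff (fun i => - d i)
    (k := Fintype.card ι - k) (by simp)
  rw [matSigma, Matrix.charpoly_diagonal]
  simp only [map_neg, ← sub_eq_add_neg] at h
  rw [h, Finset.card_univ, Nat.sub_sub_self hk, Finset.mul_sum]
  refine Finset.sum_congr rfl fun t ht => ?_
  rw [Finset.prod_neg, (Finset.mem_powersetCard.1 ht).2, ← mul_assoc, ← mul_pow]
  simp

/-- The partial derivative of `matSigma k` at `M` in the direction of the `(i, j)` entry. -/
noncomputable def matSigmaGrad (k : ℕ) (M : Matrix ι ι ℝ) (i j : ι) : ℝ :=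
  MvPolynomial.eval (fun ij : ι × ι => M ij.1 ij.2)
    (MvPolynomial.pderiv (i, j) (MvPolynomial.C ((-1) ^ k) *
        (Matrix.charpoly.univ ℝ ι).coeff (Fintype.card ι - k)))

theorem hasDerivAt_matSigma (k : ℕ) {M : ℝ → Matrix ι ι ℝ} {M' : Matrix ι ι ℝ} {s : ℝ}
    (hM : ∀ i j, HasDerivAt (fun t => M t i j) (M' i j) s) :
    HasDerivAt (fun t => matSigma k (M t)) (∑ i, ∑ j, matSigmaGrad k (M s) i j * M' i j) s := by
  simp only [matSigma_eq_eval]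
  refine (hasDerivAt_mvPolynomial_eval _ (c := fun t (ij : ι × ι) => M t ij.1 ij.2)
    (c' := fun ij => M' ij.1 ij.2) fun ij => hM ij.1 ij.2).congr_deriv ?_
  rw [Fintype.sum_prod_type]
  rfl

theorem hasDerivAt_matSigma_add_single (k : ℕ) (M : Matrix ι ι ℝ) (i j : ι) :
    HasDerivAt (fun t : ℝ => matSigma k (M + Matrix.single i j t)) (matSigmaGrad k M i j) 0 := by
  have h := hasDerivAt_matSigma k (M := fun t => M + Matrix.single i j t)
    (M' := Matrix.single i j 1) (s := 0) fun a b => by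
      simp only [Matrix.add_apply, Matrix.single_apply]
      split_ifs
      · simpa using (hasDerivAt_id (0 : ℝ)).const_add (M a b)
      · simpa using hasDerivAt_const (0 : ℝ) (M a b)
  refine h.congr_deriv ?_
  simp only [Matrix.single_zero, add_zero]
  rw [Finset.sum_eq_single i, Finset.sum_eq_single j]
  · simp
  · intro b _ hb
    simp [hb.symm]
  · simp
  · intro a _ ha
    simp [ha.symm]
  · simp

/-- Adding an off-diagonal entry to a diagonal matrix makes it triangular, with the same diagonal. -/
theorem matSigma_diagonal_add_single {ι : Type*} [Fintype ι] [LinearOrder ι] (k : ℕ) (d : ι → ℝ)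
    {i j : ι} (hij : i ≠ j) (t : ℝ) :
    matSigma k (Matrix.diagonal d + Matrix.single i j t) = matSigma k (Matrix.diagonal d) := by
  have key : (Matrix.diagonal d + Matrix.single i j t).charpoly = (Matrix.diagonal d).charpoly := by
    rw [Matrix.charpoly_diagonal, Matrix.charpoly]
    have hdiag : ∀ a, (Matrix.diagonal d + Matrix.single i j t).charmatrix a a = X - C (d a) := by
      intro a
      have : ¬ (i = a ∧ j = a) := fun h => hij (h.1.trans h.2.symm)
      simp [this]
    have hoff : ∀ a b, a ≠ b → ¬ (i = a ∧ j = b) →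
        (Matrix.diagonal d + Matrix.single i j t).charmatrix a b = 0 := by
      intro a b hab h
      simp [h, hab]
    rcases lt_or_gt_of_ne hij with h | h
    · rw [Matrix.det_of_isUpperTriangular]
      · exact Finset.prod_congr rfl fun a _ => hdiag a
      · intro a b hab
        have hab' : b < a := hab
        exact hoff a b hab'.ne' fun e => by
          rw [e.1, e.2] at h
          exact absurd h hab'.asymm
    · rw [Matrix.det_of_isLowerTriangular]
      · exact Finset.prod_congr rfl fun a _ => hdiag a
      · intro a b hab
        have hab' : a < b := by simpa using hab
        exact hoff a b hab'.ne fun e => by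
          rw [e.1, e.2] at h
          exact absurd h hab'.asymm
  rw [matSigma, matSigma, key]

theorem matSigmaGrad_diagonal_of_ne {ι : Type*} [Fintype ι] [LinearOrder ι] (k : ℕ) (d : ι → ℝ)
    {i j : ι} (hij : i ≠ j) : matSigmaGrad k (Matrix.diagonal d) i j = 0 := by
  have h := hasDerivAt_matSigma_add_single k (Matrix.diagonal d) i j
  simp only [matSigma_diagonal_add_single k d hij] at h
  exact h.unique (hasDerivAt_const _ _)

/-- `σ_k` of a nonnegative diagonal matrix is monotone in each diagonal entry. -/
theorem matSigmaGrad_diagonal_nonneg {k : ℕ} (hk : k ≤ Fintype.card ι) {d : ι → ℝ}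
    (hd : ∀ i, 0 ≤ d i) (i : ι) : 0 ≤ matSigmaGrad k (Matrix.diagonal d) i i := by
  have h := hasDerivAt_matSigma_add_single k (Matrix.diagonal d) i i
  have heq : ∀ t : ℝ, Matrix.diagonal d + Matrix.single i i t
      = Matrix.diagonal (d + Pi.single i t) := by
    intro t
    rw [← Matrix.diagonal_single, Matrix.diagonal_add]
    rfl
  have hmono : MonotoneOn (fun t : ℝ => matSigma k (Matrix.diagonal d + Matrix.single i i t))
      (Set.Ici 0) := by
    intro s hs t ht hst
    have hs : 0 ≤ s := hs
    simp only [heq, matSigma_diagonal hk]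
    refine Finset.sum_le_sum fun u _ => Finset.prod_le_prod (fun a _ => ?_) fun a _ => ?_
    · by_cases ha : a = i
      · subst ha
        simpa using add_nonneg (hd a) hs
      · simpa [ha] using hd a
    · by_cases ha : a = i
      · subst ha
        simpa using hst
      · simp [ha]
  have h' := h.hasDerivWithinAt (s := Set.Ici 0)
  rw [← h'.derivWithin (uniqueDiffOn_Ici 0 0 Set.self_mem_Ici)]
  exact hmono.derivWithin_nonneg

/-- Euler's identity for the homogeneous function `σ_k`. -/
theorem sum_matSigmaGrad_diagonal_mul {ι : Type*} [Fintype ι] [LinearOrder ι] {k : ℕ}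
    (hk : k ≤ Fintype.card ι) (d : ι → ℝ) :
    ∑ i, matSigmaGrad k (Matrix.diagonal d) i i * d i = k * matSigma k (Matrix.diagonal d) := by
  have h1 := hasDerivAt_matSigma k (M := fun t : ℝ => Matrix.diagonal fun i => t * d i)
    (M' := Matrix.diagonal d) (s := 1) fun a b => by
      by_cases hab : a = b
      · subst hab
        simpa using (hasDerivAt_id (1 : ℝ)).mul_const (d a)
      · simpa [hab] using hasDerivAt_const (1 : ℝ) (0 : ℝ)
  have h2 : HasDerivAt (fun t : ℝ => matSigma k (Matrix.diagonal fun i => t * d i))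
      (k * matSigma k (Matrix.diagonal d)) 1 := by
    have : (fun t : ℝ => matSigma k (Matrix.diagonal fun i => t * d i))
        = fun t => t ^ k * matSigma k (Matrix.diagonal d) := by
      funext t
      rw [matSigma_diagonal hk, matSigma_diagonal hk, Finset.mul_sum]
      refine Finset.sum_congr rfl fun u hu => ?_
      rw [Finset.prod_mul_distrib, Finset.prod_const, (Finset.mem_powersetCard.1 hu).2]
    rw [this]
    simpa using (hasDerivAt_pow k (1 : ℝ)).mul_const (matSigma k (Matrix.diagonal d))
  rw [← h1.unique h2]
  simp only [one_mul]
  refine Finset.sum_congr rfl fun i _ => ?_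
  rw [Finset.sum_eq_single i]
  · simp
  · intro b _ hb
    simp [hb.symm]
  · simp

/-- If `M` is a curve of matrices starting at a nonnegative diagonal matrix, and the diagonal of its
velocity is at most `κ` times the diagonal of `M 0`, then `σ_k` grows at most at the rate that
Euler's identity gives for the scaling `t ↦ (1 + κ t) M 0`. -/
theorem exists_hasDerivAt_matSigma_le {ι : Type*} [Fintype ι] [LinearOrder ι] {k : ℕ}
    (hk : k ≤ Fintype.card ι) {d : ι → ℝ} (hd : ∀ i, 0 ≤ d i) {M : ℝ → Matrix ι ι ℝ}
    {M' : Matrix ι ι ℝ} {s κ : ℝ} (hM : ∀ i j, HasDerivAt (fun t => M t i j) (M' i j) s)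
    (hM0 : M s = Matrix.diagonal d) (hle : ∀ i, M' i i ≤ κ * d i) :
    ∃ D, HasDerivAt (fun t => matSigma k (M t)) D s ∧ D ≤ κ * (k * matSigma k (M s)) := by
  refine ⟨_, hasDerivAt_matSigma k hM, ?_⟩
  rw [hM0, ← sum_matSigmaGrad_diagonal_mul hk, Finset.mul_sum]
  refine Finset.sum_le_sum fun i _ => ?_
  rw [Finset.sum_eq_single i]
  · have := mul_le_mul_of_nonneg_left (hle i) (matSigmaGrad_diagonal_nonneg hk hd i)
    linarith
  · intro b _ hb
    rw [matSigmaGrad_diagonal_of_ne k d hb.symm, zero_mul]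
  · simp

end Matrices

section Operators

variable {V : Type*} [NormedAddCommGroup V] [InnerProductSpace ℝ V] [FiniteDimensional ℝ V]

theorem sigma_eq_sum_eigenvalues {n : ℕ} (hn : Module.finrank ℝ V = n) (k : ℕ) {T : V →L[ℝ] V}
    (hT : (T : V →ₗ[ℝ] V).IsSymmetric) :
    sigma k T = ∑ t ∈ (Finset.univ : Finset (Fin n)).powersetCard k,
      ∏ i ∈ t, hT.eigenvalues hn i := by
  rw [sigma, hT.roots_charpoly_eq_eigenvalues hn, Finset.esymm_map_val]
  rfl

theorem eigenvalues_eq_inner {n : ℕ} (hn : Module.finrank ℝ V = n) {T : V →L[ℝ] V}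
    (hT : (T : V →ₗ[ℝ] V).IsSymmetric) (i : Fin n) :
    hT.eigenvalues hn i = ⟪T (hT.eigenvectorBasis hn i), hT.eigenvectorBasis hn i⟫ := by
  have h := hT.apply_eigenvectorBasis hn i
  have h' : T (hT.eigenvectorBasis hn i) = hT.eigenvalues hn i • hT.eigenvectorBasis hn i := h
  rw [h', real_inner_smul_left, real_inner_self_eq_norm_sq, (hT.eigenvectorBasis hn).norm_eq_one]
  ring

theorem sigma_le_of_inner_le {n : ℕ} (hn : Module.finrank ℝ V = n) (k : ℕ) {T : V →L[ℝ] V}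
    (hT : (T : V →ₗ[ℝ] V).IsSymmetric) (hpos : ∀ a, 0 ≤ ⟪T a, a⟫) {c : ℝ}
    (hle : ∀ a, ⟪T a, a⟫ ≤ c * ‖a‖ ^ 2) : sigma k T ≤ n.choose k * c ^ k := by
  rw [sigma_eq_sum_eigenvalues hn k hT]
  have : ∀ t ∈ (Finset.univ : Finset (Fin n)).powersetCard k,
      ∏ i ∈ t, hT.eigenvalues hn i ≤ c ^ k := by
    intro t ht
    rw [← (Finset.mem_powersetCard.1 ht).2, ← Finset.prod_const]
    refine Finset.prod_le_prod (fun i _ => ?_) fun i _ => ?_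
    · rw [eigenvalues_eq_inner]
      exact hpos _
    · rw [eigenvalues_eq_inner]
      refine (hle _).trans_eq ?_
      rw [(hT.eigenvectorBasis hn).norm_eq_one]
      ring
  refine (Finset.sum_le_card_nsmul _ _ _ this).trans_eq ?_
  simp

theorem le_sigma_of_le_inner {n : ℕ} (hn : Module.finrank ℝ V = n) (k : ℕ) {T : V →L[ℝ] V}
    (hT : (T : V →ₗ[ℝ] V).IsSymmetric) {c : ℝ} (hc : 0 ≤ c)
    (hle : ∀ a, c * ‖a‖ ^ 2 ≤ ⟪T a, a⟫) : n.choose k * c ^ k ≤ sigma k T := by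
  rw [sigma_eq_sum_eigenvalues hn k hT]
  have : ∀ t ∈ (Finset.univ : Finset (Fin n)).powersetCard k,
      c ^ k ≤ ∏ i ∈ t, hT.eigenvalues hn i := by
    intro t ht
    rw [← (Finset.mem_powersetCard.1 ht).2, ← Finset.prod_const]
    refine Finset.prod_le_prod (fun i _ => hc) fun i _ => ?_
    rw [eigenvalues_eq_inner]
    refine le_trans (le_of_eq ?_) (hle _)
    rw [(hT.eigenvectorBasis hn).norm_eq_one]
    ring
  refine le_trans (le_of_eq ?_) (Finset.card_nsmul_le_sum _ _ _ this)
  simp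

/-- If all elementary symmetric functions are positive, then so is `∏ (t + λ_i)` for `t ≥ 0`, so no
eigenvalue is `-t`. -/
theorem eigenvalues_pos_of_sigma_pos {n : ℕ} (hn : Module.finrank ℝ V = n) {T : V →L[ℝ] V}
    (hT : (T : V →ₗ[ℝ] V).IsSymmetric) (h : ∀ i, 1 ≤ i → i ≤ n → 0 < sigma i T) (i : Fin n) :
    0 < hT.eigenvalues hn i := by
  by_contra hneg
  push Not at hneg
  have hroots := hT.roots_charpoly_eq_eigenvalues hn
  set R := (LinearMap.charpoly (T : V →ₗ[ℝ] V)).roots with hR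
  have hcard : R.card = n := by rw [hroots]; simp
  have hV := congrArg (Polynomial.eval (-hT.eigenvalues hn i)) (Multiset.prod_X_add_C_eq_sum_esymm R)
  rw [hcard, Polynomial.eval_finsetSum] at hV
  have hzero : Polynomial.eval (-hT.eigenvalues hn i)
      (R.map fun r => Polynomial.X + Polynomial.C r).prod = 0 := by
    rw [Polynomial.eval_multiset_prod, Multiset.map_map]
    refine Multiset.prod_eq_zero (Multiset.mem_map.2 ⟨hT.eigenvalues hn i, ?_, by simp⟩)
    rw [hroots]
    exact Multiset.mem_map.2 ⟨i, Finset.mem_univ_val i, rfl⟩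
  rw [hzero] at hV
  have hn1 : 1 ≤ n := i.pos
  have hpos : 0 < ∑ j ∈ Finset.range (n + 1), Polynomial.eval (-hT.eigenvalues hn i)
      (Polynomial.C (R.esymm j) * Polynomial.X ^ (n - j)) := by
    simp only [Polynomial.eval_mul, Polynomial.eval_C, Polynomial.eval_pow, Polynomial.eval_X]
    refine Finset.sum_pos' (fun j hj => ?_) ⟨n, by simp, ?_⟩
    · refine mul_nonneg ?_ (pow_nonneg (by linarith) _)
      rcases Nat.eq_zero_or_pos j with rfl | hj0
      · simp [Multiset.esymm]
      · exact (h j hj0 (Nat.lt_succ_iff.1 (Finset.mem_range.1 hj))).le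
    · simp only [Nat.sub_self, pow_zero, mul_one]
      exact h n hn1 le_rfl
  exact hpos.ne hV

theorem inner_pos_of_sigma_pos {n : ℕ} (hn : Module.finrank ℝ V = n) {T : V →L[ℝ] V}
    (hT : (T : V →ₗ[ℝ] V).IsSymmetric) (h : ∀ i, 1 ≤ i → i ≤ n → 0 < sigma i T) {a : V}
    (ha : a ≠ 0) : 0 < ⟪T a, a⟫ := by
  set b := hT.eigenvectorBasis hn
  have hexp : ⟪T a, a⟫ = ∑ i, hT.eigenvalues hn i * ⟪a, b i⟫ ^ 2 := by
    rw [← b.sum_inner_mul_inner (T a) a]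
    refine Finset.sum_congr rfl fun i _ => ?_
    have h1 : ⟪T a, b i⟫ = ⟪a, T (b i)⟫ := hT a (b i)
    have h2 : T (b i) = hT.eigenvalues hn i • b i := hT.apply_eigenvectorBasis hn i
    rw [h1, h2, real_inner_smul_right, real_inner_comm a (b i)]
    ring
  rw [hexp]
  have hex : ∃ i, ⟪a, b i⟫ ≠ 0 := by
    by_contra hcon
    push Not at hcon
    refine ha ?_
    rw [← b.sum_repr' a]
    refine Finset.sum_eq_zero fun i _ => ?_
    rw [real_inner_comm, hcon i, zero_smul]
  obtain ⟨i, hi⟩ := hex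
  refine Finset.sum_pos' (fun j _ => ?_) ⟨i, Finset.mem_univ _, ?_⟩
  · exact mul_nonneg (eigenvalues_pos_of_sigma_pos hn hT h j).le (sq_nonneg _)
  · exact mul_pos (eigenvalues_pos_of_sigma_pos hn hT h i) (by positivity)

/-- A self-adjoint operator that annihilates a unit vector `y` has, up to a zero eigenvalue, the
eigenvalues of its restriction to `y^⊥`. -/
theorem matSigma_eq_sigma_restrict {ι : Type*} [Fintype ι] [DecidableEq ι]
    (b : OrthonormalBasis ι ℝ V) {n k : ℕ} (hV : Module.finrank ℝ V = n + 1) (hk : k ≤ n)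
    {A : V →L[ℝ] V} {y : V} (hy : y ≠ 0) (hAy : A y = 0)
    {T : (ℝ ∙ y)ᗮ →L[ℝ] (ℝ ∙ y)ᗮ} (hT : (T : (ℝ ∙ y)ᗮ →ₗ[ℝ] (ℝ ∙ y)ᗮ).IsSymmetric)
    (hAT : ∀ a : (ℝ ∙ y)ᗮ, (T a : V) = A a) :
    matSigma k (Matrix.of fun i j => ⟪b i, A (b j)⟫) = sigma k T := by
  have hfin : Module.finrank ℝ (ℝ ∙ y)ᗮ = n := by
    have : Fact (Module.finrank ℝ V = n + 1) := ⟨hV⟩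
    exact Submodule.finrank_orthogonal_span_singleton hy
  have hM : (Matrix.of fun i j => ⟪b i, A (b j)⟫)
      = LinearMap.toMatrix b.toBasis b.toBasis (A : V →ₗ[ℝ] V) := by
    ext i j
    simp [LinearMap.toMatrix_apply, b.repr_apply_apply]
  have hcompl : IsCompl (ℝ ∙ y) (ℝ ∙ y)ᗮ := Submodule.isCompl_orthogonal _
  set e := Submodule.prodEquivOfIsCompl _ _ hcompl
  have hconj : (A : V →ₗ[ℝ] V)
      = e.conj ((0 : (ℝ ∙ y) →ₗ[ℝ] (ℝ ∙ y)).prodMap (T : (ℝ ∙ y)ᗮ →ₗ[ℝ] (ℝ ∙ y)ᗮ)) := by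
    ext v
    obtain ⟨⟨u, w⟩, rfl⟩ := e.surjective v
    rw [LinearEquiv.conj_apply_apply, LinearEquiv.symm_apply_apply]
    obtain ⟨c, hc⟩ := Submodule.mem_span_singleton.1 u.2
    simp only [e, Submodule.coe_prodEquivOfIsCompl', LinearMap.prodMap_apply]
    simp [hAT, ← hc, hAy]
  have hchar : (Matrix.of fun i j => ⟪b i, A (b j)⟫).charpoly
      = Polynomial.X * LinearMap.charpoly (T : (ℝ ∙ y)ᗮ →ₗ[ℝ] (ℝ ∙ y)ᗮ) := by
    rw [hM, LinearMap.charpoly_toMatrix, hconj, LinearEquiv.charpoly_conj,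
      LinearMap.charpoly_prodMap, LinearMap.charpoly_zero, finrank_span_singleton hy, pow_one]
  have hcard : Fintype.card ι = n + 1 := by
    rw [← hV, Module.finrank_eq_card_basis b.toBasis]
  have hdeg : (LinearMap.charpoly (T : (ℝ ∙ y)ᗮ →ₗ[ℝ] (ℝ ∙ y)ᗮ)).natDegree = n := by
    rw [LinearMap.charpoly_natDegree, hfin]
  have hv := Polynomial.coeff_eq_esymm_roots_of_splits hT.splits_charpoly
    (k := n - k) (by rw [hdeg]; omega)
  rw [hdeg, Nat.sub_sub_self hk, (LinearMap.charpoly_monic _).leadingCoeff] at hv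
  rw [matSigma, hchar, hcard, Nat.succ_sub hk, Polynomial.coeff_X_mul, hv, sigma, one_mul,
    ← mul_assoc, ← mul_pow]
  simp

end Operators

/-! ### Homogeneous functions and the homogeneous extension of a function on the sphere -/

section Homogeneous

variable {E : Type*} [NormedAddCommGroup E] [InnerProductSpace ℝ E]

/-- A function that is smooth away from the origin and positively homogeneous of degree one. -/
structure SmoothHomogeneous (H : E → ℝ) : Prop where
  contDiffAt : ∀ y, y ≠ 0 → ContDiffAt ℝ ∞ H y
  map_smul : ∀ c : ℝ, 0 < c → ∀ y, H (c • y) = c * H y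

namespace SmoothHomogeneous

variable {H : E → ℝ} (hH : SmoothHomogeneous H)
include hH

theorem contDiffAt_fderiv {y : E} (hy : y ≠ 0) : ContDiffAt ℝ ∞ (fderiv ℝ H) y :=
  (hH.contDiffAt y hy).fderiv_right (by simp)

theorem contDiffAt_fderiv_fderiv {y : E} (hy : y ≠ 0) :
    ContDiffAt ℝ ∞ (fderiv ℝ (fderiv ℝ H)) y :=
  (hH.contDiffAt_fderiv hy).fderiv_right (by simp)

theorem hasFDerivAt {y : E} (hy : y ≠ 0) : HasFDerivAt H (fderiv ℝ H y) y :=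
  ((hH.contDiffAt y hy).differentiableAt (by simp)).hasFDerivAt

theorem hasFDerivAt_fderiv {y : E} (hy : y ≠ 0) :
    HasFDerivAt (fderiv ℝ H) (fderiv ℝ (fderiv ℝ H) y) y :=
  ((hH.contDiffAt_fderiv hy).differentiableAt (by simp)).hasFDerivAt

theorem hasFDerivAt_fderiv_fderiv {y : E} (hy : y ≠ 0) :
    HasFDerivAt (fderiv ℝ (fderiv ℝ H)) (fderiv ℝ (fderiv ℝ (fderiv ℝ H)) y) y :=
  ((hH.contDiffAt_fderiv_fderiv hy).differentiableAt (by simp)).hasFDerivAt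

theorem fderiv_fderiv_comm {y : E} (hy : y ≠ 0) (a b : E) :
    fderiv ℝ (fderiv ℝ H) y a b = fderiv ℝ (fderiv ℝ H) y b a :=
  (hH.contDiffAt y hy).isSymmSndFDerivAt (by simpa using ENat.LEInfty.out) a b

theorem fderiv_apply_self {y : E} (hy : y ≠ 0) : fderiv ℝ H y y = H y := by
  have h1 : HasDerivAt (fun c : ℝ => c • y) y 1 := by
    simpa using (hasDerivAt_id (1 : ℝ)).smul_const y
  have h2 : HasDerivAt (fun c : ℝ => H (c • y)) (fderiv ℝ H y y) 1 :=
    HasFDerivAt.comp_hasDerivAt_of_eq 1 (hH.hasFDerivAt hy) h1 (by simp)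
  have h3 : HasDerivAt (fun c : ℝ => H (c • y)) (H y) 1 := by
    have : HasDerivAt (fun c : ℝ => c * H y) (H y) 1 := by
      simpa using (hasDerivAt_id (1 : ℝ)).mul_const (H y)
    refine this.congr_of_eventuallyEq ?_
    filter_upwards [lt_mem_nhds (zero_lt_one' ℝ)] with c hc using hH.map_smul c hc y
  exact h2.unique h3

theorem fderiv_smul {y : E} (hy : y ≠ 0) {c : ℝ} (hc : 0 < c) :
    fderiv ℝ H (c • y) = fderiv ℝ H y := by
  have hcy : c • y ≠ 0 := smul_ne_zero hc.ne' hy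
  have h1 : HasFDerivAt (fun z : E => c • z) (c • ContinuousLinearMap.id ℝ E) y :=
    (hasFDerivAt_id y).const_smul c
  have h2 := (hH.hasFDerivAt hcy).comp y h1
  have h3 : HasFDerivAt (fun z => c * H z) (c • fderiv ℝ H y) y := (hH.hasFDerivAt hy).const_mul c
  have h4 := h2.unique (h3.congr_of_eventuallyEq (.of_forall fun z => hH.map_smul c hc z))
  ext v
  have h5 := congrArg (fun L : E →L[ℝ] ℝ => L v) h4
  simp only [ContinuousLinearMap.comp_apply, smul_apply,
    ContinuousLinearMap.id_apply, smul_eq_mul] at h5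
  rw [(fderiv ℝ H (c • y)).map_smul, smul_eq_mul] at h5
  exact mul_left_cancel₀ hc.ne' h5

theorem fderiv_fderiv_apply_self {y : E} (hy : y ≠ 0) : fderiv ℝ (fderiv ℝ H) y y = 0 := by
  have h1 : HasDerivAt (fun c : ℝ => c • y) y 1 := by
    simpa using (hasDerivAt_id (1 : ℝ)).smul_const y
  have h2 : HasDerivAt (fun c : ℝ => fderiv ℝ H (c • y)) (fderiv ℝ (fderiv ℝ H) y y) 1 :=
    HasFDerivAt.comp_hasDerivAt_of_eq 1 (hH.hasFDerivAt_fderiv hy) h1 (by simp)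
  have h3 : HasDerivAt (fun c : ℝ => fderiv ℝ H (c • y)) 0 1 := by
    refine (hasDerivAt_const (1 : ℝ) (fderiv ℝ H y)).congr_of_eventuallyEq ?_
    filter_upwards [lt_mem_nhds (zero_lt_one' ℝ)] with c hc using hH.fderiv_smul hy hc
  exact h2.unique h3

theorem fderiv_fderiv_smul {y : E} (hy : y ≠ 0) {c : ℝ} (hc : 0 < c) (a b : E) :
    fderiv ℝ (fderiv ℝ H) y a b = c * fderiv ℝ (fderiv ℝ H) (c • y) a b := by
  have hcy : c • y ≠ 0 := smul_ne_zero hc.ne' hy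
  have h1 : HasFDerivAt (fun z : E => c • z) (c • ContinuousLinearMap.id ℝ E) y :=
    (hasFDerivAt_id y).const_smul c
  have h2 := (hH.hasFDerivAt_fderiv hcy).comp y h1
  have h4 := (hH.hasFDerivAt_fderiv hy).unique (h2.congr_of_eventuallyEq (by
    filter_upwards [isOpen_ne.mem_nhds hy] with z hz using (hH.fderiv_smul hz hc).symm))
  rw [h4]
  simp

theorem third_fderiv_comm {x : E} (hx : x ≠ 0) (e a : E) :
    fderiv ℝ (fderiv ℝ (fderiv ℝ H)) x e a a = fderiv ℝ (fderiv ℝ (fderiv ℝ H)) x a a e := by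
  have h1 : fderiv ℝ (fderiv ℝ (fderiv ℝ H)) x e a = fderiv ℝ (fderiv ℝ (fderiv ℝ H)) x a e :=
    (hH.contDiffAt_fderiv hx).isSymmSndFDerivAt (by simpa using ENat.LEInfty.out) e a
  have h2 : ∀ u v : E, HasFDerivAt (fun y => fderiv ℝ (fderiv ℝ H) y u v)
      (((ContinuousLinearMap.apply ℝ ℝ v).comp
        ((ContinuousLinearMap.apply ℝ (E →L[ℝ] ℝ) u))).comp
          (fderiv ℝ (fderiv ℝ (fderiv ℝ H)) x)) x := fun u v =>
    HasFDerivAt.comp (g := ((ContinuousLinearMap.apply ℝ ℝ v).comp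
      ((ContinuousLinearMap.apply ℝ (E →L[ℝ] ℝ) u)))) x (ContinuousLinearMap.hasFDerivAt _)
        (hH.hasFDerivAt_fderiv_fderiv hx)
  have h3 := (h2 e a).unique ((h2 a e).congr_of_eventuallyEq (by
    filter_upwards [isOpen_ne.mem_nhds hx] with z hz using hH.fderiv_fderiv_comm hz e a))
  rw [h1]
  exact congrArg (fun L : E →L[ℝ] ℝ => L a) h3

/-- The derivative of `D²H y y = 0`. -/
theorem third_fderiv_apply_self {x : E} (hx : x ≠ 0) (e : E) :
    fderiv ℝ (fderiv ℝ (fderiv ℝ H)) x e x x = 0 := by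
  have h1 := (hH.hasFDerivAt_fderiv_fderiv hx).clm_apply (hasFDerivAt_id x)
  have h2 : HasFDerivAt (fun y => fderiv ℝ (fderiv ℝ H) y (id y)) (0 : E →L[ℝ] E →L[ℝ] ℝ) x := by
    refine (hasFDerivAt_const (0 : E →L[ℝ] ℝ) x).congr_of_eventuallyEq ?_
    filter_upwards [isOpen_ne.mem_nhds hx] with z hz using hH.fderiv_fderiv_apply_self hz
  have h3 := congrArg (fun L : E →L[ℝ] E →L[ℝ] ℝ => L e x) (h1.unique h2)
  have h4 : fderiv ℝ (fderiv ℝ H) x e x = 0 := by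
    rw [hH.fderiv_fderiv_comm hx, hH.fderiv_fderiv_apply_self hx]
    rfl
  simpa [h4] using h3

end SmoothHomogeneous

end Homogeneous

section RadialExtension

variable {n : ℕ}

/-- The radial projection of a nonzero vector to the unit sphere. -/
noncomputable def toSph (y : Euc n) (hy : y ≠ 0) : Sph n :=
  ⟨‖y‖⁻¹ • y, by simp [norm_smul, hy]⟩

theorem radExt_eq (h : Sph n → ℝ) {y : Euc n} (hy : y ≠ 0) : radExt h y = h (toSph y hy) :=
  Subtype.val_injective.extend_apply h 0 (toSph y hy)

theorem radExt_smul (h : Sph n → ℝ) {c : ℝ} (hc : 0 < c) (y : Euc n) :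
    radExt h (c • y) = radExt h y := by
  unfold radExt
  rw [norm_smul, Real.norm_of_nonneg hc.le, smul_smul, mul_inv, mul_right_comm,
    inv_mul_cancel₀ hc.ne', one_mul]

theorem coe_ne_zero (x : Sph n) : (x : Euc n) ≠ 0 := ne_zero_of_mem_unit_sphere x

theorem norm_coe (x : Sph n) : ‖(x : Euc n)‖ = 1 := norm_eq_of_mem_sphere x

/-- Away from the origin `radExt h` is `h` composed with the radial projection, so it is as smooth
as `h`. -/
theorem contDiffAt_radExt {m : ℕ∞ω} {h : Sph n → ℝ} (hh : ContMDiff (𝓡 n) 𝓘(ℝ, ℝ) m h)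
    {y : Euc n} (hy : y ≠ 0) : ContDiffAt ℝ m (radExt h) y := by
  have := Fact.mk (@finrank_euclideanSpace_fin ℝ _ (n + 1))
  let U : TopologicalSpace.Opens (Euc n) := ⟨{0}ᶜ, isOpen_compl_singleton⟩
  have hU : ∀ z : U, (z : Euc n) ≠ 0 := fun z => z.2
  have h1 : ContMDiff 𝓘(ℝ, Euc n) 𝓘(ℝ, Euc n) m
      (fun z : U => ‖(z : Euc n)‖⁻¹ • (z : Euc n)) := by
    intro z
    have : ContDiffAt ℝ m (fun z : Euc n => ‖z‖⁻¹ • z) (z : Euc n) :=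
      ((contDiffAt_norm ℝ (hU z)).inv (norm_ne_zero_iff.2 (hU z))).smul contDiffAt_id
    exact contMDiffAt_subtype_iff.2 this.contMDiffAt
  have h2 := hh.comp (h1.codRestrict_sphere (n := n) fun z => (toSph (z : Euc n) (hU z)).2)
  have h3 : ContMDiffAt 𝓘(ℝ, Euc n) 𝓘(ℝ, ℝ) m (fun z : U => radExt h (z : Euc n)) ⟨y, hy⟩ := by
    refine (h2 ⟨y, hy⟩).congr_of_eventuallyEq (.of_forall fun z => ?_)
    exact radExt_eq h (hU z)
  exact (contMDiffAt_subtype_iff (f := radExt h) (x := (⟨y, hy⟩ : U))).1 h3 |>.contDiffAt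

/-- The extension of a function on the sphere that is positively homogeneous of degree one. For the
support function of a convex body this is the support function on all of `ℝⁿ⁺¹`. -/
noncomputable def homExt (h : Sph n → ℝ) (y : Euc n) : ℝ := ‖y‖ * radExt h y

theorem homExt_coe (h : Sph n → ℝ) (x : Sph n) : homExt h x = h x := by
  rw [homExt, radExt_coe, norm_coe, one_mul]

theorem homExt_eq (h : Sph n → ℝ) {y : Euc n} (hy : y ≠ 0) :
    homExt h y = ‖y‖ * h (toSph y hy) := by
  rw [homExt, radExt_eq h hy]

theorem smoothHomogeneous_homExt {h : Sph n → ℝ} (hh : ContMDiff (𝓡 n) 𝓘(ℝ, ℝ) ∞ h) :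
    SmoothHomogeneous (homExt h) where
  contDiffAt y hy := (contDiffAt_norm ℝ hy).mul (contDiffAt_radExt hh hy)
  map_smul c hc y := by
    rw [homExt, homExt, radExt_smul h hc, norm_smul, Real.norm_of_nonneg hc.le, mul_assoc]

/-- The Riesz isomorphism from the dual of a real inner product space, as a linear map. -/
noncomputable def rieszCLM (E : Type*) [NormedAddCommGroup E] [InnerProductSpace ℝ E]
    [CompleteSpace E] : StrongDual ℝ E →L[ℝ] E :=
  LinearMap.mkContinuous
    { toFun := (InnerProductSpace.toDual ℝ E).symm
      map_add' := fun a b => map_add _ a b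
      map_smul' := fun c a => by simp } 1 fun a => by simp

theorem inner_rieszCLM {E : Type*} [NormedAddCommGroup E] [InnerProductSpace ℝ E]
    [CompleteSpace E] (L : StrongDual ℝ E) (v : E) : ⟪rieszCLM E L, v⟫ = L v :=
  InnerProductSpace.toDual_symm_apply

theorem inner_sphGrad (h : Sph n → ℝ) (x : Sph n) (v : Euc n) :
    ⟪sphGrad h x, v⟫ = fderiv ℝ (radExt h) x v := by
  rw [sphGrad, gradient, InnerProductSpace.toDual_symm_apply]

theorem inner_sphGrad_coe {h : Sph n → ℝ} (hh : ContMDiff (𝓡 n) 𝓘(ℝ, ℝ) 1 h) (x : Sph n) :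
    ⟪sphGrad h x, (x : Euc n)⟫ = 0 := by
  have hx := coe_ne_zero x
  rw [inner_sphGrad]
  have h1 : HasDerivAt (fun c : ℝ => c • (x : Euc n)) x 1 := by
    simpa using (hasDerivAt_id (1 : ℝ)).smul_const (x : Euc n)
  have h2 : HasDerivAt (fun c : ℝ => radExt h (c • (x : Euc n)))
      (fderiv ℝ (radExt h) (x : Euc n) (x : Euc n)) 1 :=
    HasFDerivAt.comp_hasDerivAt_of_eq (l := radExt h) 1
      (((contDiffAt_radExt hh hx).differentiableAt (by simp)).hasFDerivAt) h1 (by simp)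
  have h3 : HasDerivAt (fun c : ℝ => radExt h (c • (x : Euc n))) 0 1 := by
    refine (hasDerivAt_const (1 : ℝ) (radExt h (x : Euc n))).congr_of_eventuallyEq ?_
    filter_upwards [lt_mem_nhds (zero_lt_one' ℝ)] with c hc using radExt_smul h hc _
  exact h2.unique h3

theorem hasFDerivAt_norm_of_ne {E : Type*} [NormedAddCommGroup E] [InnerProductSpace ℝ E] {y : E}
    (hy : y ≠ 0) : HasFDerivAt (fun z : E => ‖z‖) (‖y‖⁻¹ • innerSL ℝ y) y := by
  have h1 := (hasStrictFDerivAt_norm_sq y).hasFDerivAt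
  have h2 := h1.sqrt (by positivity)
  simp only [Real.sqrt_sq (norm_nonneg _)] at h2
  refine h2.congr_fderiv ?_
  ext v
  simp
  field_simp

theorem fderiv_homExt {h : Sph n → ℝ} (hh : ContMDiff (𝓡 n) 𝓘(ℝ, ℝ) 1 h) {y : Euc n}
    (hy : y ≠ 0) : fderiv ℝ (homExt h) y =
      ‖y‖ • fderiv ℝ (radExt h) y + radExt h y • (‖y‖⁻¹ • innerSL ℝ y) :=
  ((hasFDerivAt_norm_of_ne hy).mul
    ((contDiffAt_radExt hh hy).differentiableAt (by simp)).hasFDerivAt).fderiv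

theorem fderiv_homExt_coe {h : Sph n → ℝ} (hh : ContMDiff (𝓡 n) 𝓘(ℝ, ℝ) 1 h) (x : Sph n)
    (v : Euc n) : fderiv ℝ (homExt h) x v = ⟪sphGrad h x + h x • (x : Euc n), v⟫ := by
  rw [fderiv_homExt hh (coe_ne_zero x), inner_add_left, inner_sphGrad, real_inner_smul_left,
    norm_coe, radExt_coe]
  simp

/-- On the tangent space the Hessian of the homogeneous extension is `∇²h + h I`. -/
theorem fderiv_fderiv_homExt_coe {h : Sph n → ℝ} (hh : ContMDiff (𝓡 n) 𝓘(ℝ, ℝ) ∞ h) (x : Sph n)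
    (a b : Tan x) : fderiv ℝ (fderiv ℝ (homExt h)) x a b = ⟪radiiOp h x a, b⟫ := by
  have hx := coe_ne_zero x
  have hh1 : ContMDiff (𝓡 n) 𝓘(ℝ, ℝ) 1 h := hh.of_le (by simp)
  have hxa : ⟪(x : Euc n), (a : Euc n)⟫ = 0 :=
    Submodule.mem_orthogonal_singleton_iff_inner_right.1 a.2
  have hxb : ⟪(x : Euc n), (b : Euc n)⟫ = 0 :=
    Submodule.mem_orthogonal_singleton_iff_inner_right.1 b.2
  have hu := contDiffAt_radExt hh hx
  have hu1 : HasFDerivAt (fderiv ℝ (radExt h)) (fderiv ℝ (fderiv ℝ (radExt h)) x) (x : Euc n) :=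
    ((hu.fderiv_right (m := ∞) (by simp)).differentiableAt (by simp)).hasFDerivAt
  have hN := hasFDerivAt_norm_of_ne hx
  -- the right side: the tangential projection is removed by pairing with `b`
  have hgrad : ⟪fderiv ℝ (gradient (radExt h)) x (a : Euc n), (b : Euc n)⟫
      = fderiv ℝ (fderiv ℝ (radExt h)) x a b := by
    have h1 : HasFDerivAt (gradient (radExt h))
        ((rieszCLM (Euc n)).comp (fderiv ℝ (fderiv ℝ (radExt h)) x)) (x : Euc n) :=
      (rieszCLM (Euc n)).hasFDerivAt.comp (x : Euc n) hu1
    rw [h1.fderiv]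
    exact inner_rieszCLM _ _
  have hR : ⟪radiiOp h x a, b⟫ = fderiv ℝ (fderiv ℝ (radExt h)) x a b
      + h x * ⟪(a : Euc n), (b : Euc n)⟫ := by
    rw [radiiOp, add_apply, inner_add_left, smul_apply,
      real_inner_smul_left, ContinuousLinearMap.id_apply, Submodule.coe_inner, sphHess]
    congr 1
    rw [ContinuousLinearMap.comp_apply, ← hgrad, ← Submodule.coe_inner,
      Submodule.inner_orthogonalProjectionOnto_eq_of_mem_right]
    rfl
  have hA : HasFDerivAt (fun y : Euc n => ‖y‖ * fderiv ℝ (radExt h) y b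
      + radExt h y * (‖y‖⁻¹ * ⟪y, (b : Euc n)⟫)) (fderiv ℝ (fderiv ℝ (homExt h)) x |>.flip b)
      (x : Euc n) := by
    have h1 := ((smoothHomogeneous_homExt hh).hasFDerivAt_fderiv hx).clm_apply
      (hasFDerivAt_const (b : Euc n) (x : Euc n))
    simp only [ContinuousLinearMap.comp_zero, zero_add] at h1
    refine h1.congr_of_eventuallyEq ?_
    filter_upwards [isOpen_ne.mem_nhds hx] with z hz
    rw [fderiv_homExt hh1 hz]
    simp
  have hub := hu1.clm_apply (hasFDerivAt_const (b : Euc n) (x : Euc n))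
  have hinv : HasFDerivAt (fun y : Euc n => ‖y‖⁻¹) _ (x : Euc n) :=
    (hasDerivAt_inv (norm_ne_zero_iff.2 hx)).comp_hasFDerivAt (x : Euc n) hN
  have hi : HasFDerivAt (fun y : Euc n => ⟪y, (b : Euc n)⟫) (innerSL ℝ (b : Euc n)) (x : Euc n) := by
    refine (innerSL ℝ (b : Euc n)).hasFDerivAt.congr_of_eventuallyEq (.of_forall fun y => ?_)
    simp [real_inner_comm]
  have hB := (hN.mul hub).add ((hu.differentiableAt (by simp)).hasFDerivAt.mul (hinv.mul hi))
  have h2 := congrArg (fun L : Euc n →L[ℝ] ℝ => L a) (hA.unique hB)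
  simp only [ContinuousLinearMap.flip_apply] at h2
  rw [h2, hR]
  simp [hxa, hxb, radExt_coe, real_inner_comm]

end RadialExtension

/-! ### Convexity and second derivative tests for homogeneous functions -/

theorem nonpos_of_isLocalMax_of_hasDerivAt {φ φ' : ℝ → ℝ} {d : ℝ}
    (h1 : ∀ t, HasDerivAt φ (φ' t) t) (h2 : HasDerivAt φ' d 0) (hmax : IsLocalMax φ 0) :
    d ≤ 0 := by
  by_contra hd
  push Not at hd
  have hderiv : deriv φ = φ' := funext fun t => (h1 t).deriv
  have hmin : IsLocalMin φ 0 :=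
    isLocalMin_of_deriv_deriv_pos (by rw [hderiv, h2.deriv]; exact hd) hmax.deriv_eq_zero
      (h1 0).continuousAt
  -- a function with a local maximum and a local minimum at `0` is constant near `0`
  have hconst : φ =ᶠ[nhds 0] fun _ => φ 0 := by
    filter_upwards [hmax, hmin] with t h h' using le_antisymm h h'
  have h0 : deriv (deriv φ) 0 = 0 := by
    rw [hconst.deriv.deriv_eq]
    simp
  rw [hderiv, h2.deriv] at h0
  exact hd.ne' h0

section Lines

variable {E : Type*} [NormedAddCommGroup E] [InnerProductSpace ℝ E]

theorem hasDerivAt_line (x a : E) (t : ℝ) : HasDerivAt (fun s : ℝ => x + s • a) a t := by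
  simpa using ((hasDerivAt_id t).smul_const a).const_add x

namespace SmoothHomogeneous

variable {H : E → ℝ} (hH : SmoothHomogeneous H)
include hH

theorem hasDerivAt_line {x a : E} {t : ℝ} (hy : x + t • a ≠ 0) :
    HasDerivAt (fun s : ℝ => H (x + s • a)) (fderiv ℝ H (x + t • a) a) t :=
  (hH.hasFDerivAt hy).comp_hasDerivAt t (ChristoffelMinkowski.hasDerivAt_line x a t)

theorem hasDerivAt_fderiv_line {x a : E} {t : ℝ} (hy : x + t • a ≠ 0) :
    HasDerivAt (fun s : ℝ => fderiv ℝ H (x + s • a)) (fderiv ℝ (fderiv ℝ H) (x + t • a) a) t :=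
  (hH.hasFDerivAt_fderiv hy).comp_hasDerivAt t (ChristoffelMinkowski.hasDerivAt_line x a t)

theorem hasDerivAt_fderiv_line_apply {x a : E} {t : ℝ} (hy : x + t • a ≠ 0) (v : E) :
    HasDerivAt (fun s : ℝ => fderiv ℝ H (x + s • a) v)
      (fderiv ℝ (fderiv ℝ H) (x + t • a) a v) t := by
  simpa using (hH.hasDerivAt_fderiv_line hy).clm_apply (hasDerivAt_const t v)

theorem hasDerivAt_fderiv_fderiv_line {x a : E} {t : ℝ} (hy : x + t • a ≠ 0) :
    HasDerivAt (fun s : ℝ => fderiv ℝ (fderiv ℝ H) (x + s • a))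
      (fderiv ℝ (fderiv ℝ (fderiv ℝ H)) (x + t • a) a) t :=
  HasFDerivAt.comp_hasDerivAt (l := fderiv ℝ (fderiv ℝ H)) t (hH.hasFDerivAt_fderiv_fderiv hy)
    (ChristoffelMinkowski.hasDerivAt_line x a t)

end SmoothHomogeneous

theorem norm_sq_line {x a : E} (hx : ‖x‖ = 1) (ha : ‖a‖ = 1) (hxa : ⟪x, a⟫ = 0) (t : ℝ) :
    ‖x + t • a‖ ^ 2 = 1 + t ^ 2 := by
  rw [norm_add_sq_real, hx, norm_smul, ha, real_inner_smul_right, hxa]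
  simp

theorem line_ne_zero {x a : E} (hx : ‖x‖ = 1) (ha : ‖a‖ = 1) (hxa : ⟪x, a⟫ = 0) (t : ℝ) :
    x + t • a ≠ 0 := by
  intro h
  have := norm_sq_line hx ha hxa t
  rw [h, norm_zero] at this
  nlinarith [sq_nonneg t]

theorem norm_line {x a : E} (hx : ‖x‖ = 1) (ha : ‖a‖ = 1) (hxa : ⟪x, a⟫ = 0) (t : ℝ) :
    ‖x + t • a‖ = √(1 + t ^ 2) := by
  rw [← norm_sq_line hx ha hxa t, Real.sqrt_sq (norm_nonneg _)]

end Lines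

section Convex

variable {E : Type*} [NormedAddCommGroup E] [InnerProductSpace ℝ E]

/-- The Hessian at unit vectors `x` is positive definite on `x^⊥`. For a function that is
homogeneous of degree one, `x` itself is in the kernel of the Hessian. -/
def TangentiallyPosDef (H : E → ℝ) : Prop :=
  ∀ x : E, ‖x‖ = 1 → ∀ a : E, ⟪x, a⟫ = 0 → a ≠ 0 → 0 < fderiv ℝ (fderiv ℝ H) x a a

namespace SmoothHomogeneous

variable {H : E → ℝ} (hH : SmoothHomogeneous H) (hpos : TangentiallyPosDef H)
include hH hpos

theorem hess_pos {y a : E} (hy : y ≠ 0) (ha : ∀ c : ℝ, a ≠ c • y) :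
    0 < fderiv ℝ (fderiv ℝ H) y a a := by
  have hc : 0 < ‖y‖⁻¹ := inv_pos.2 (norm_pos_iff.2 hy)
  rw [hH.fderiv_fderiv_smul hy hc]
  refine mul_pos hc ?_
  set x := ‖y‖⁻¹ • y with hx
  have hx1 : ‖x‖ = 1 := by simp [hx, norm_smul, hy]
  have hx0 : x ≠ 0 := smul_ne_zero hc.ne' hy
  have hsplit : a = ⟪x, a⟫ • x + (a - ⟪x, a⟫ • x) := by abel
  have h1 := hH.fderiv_fderiv_apply_self hx0
  have h2 : ∀ b, fderiv ℝ (fderiv ℝ H) x b x = 0 := fun b => by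
    rw [hH.fderiv_fderiv_comm hx0, h1]
    rfl
  have h3 : fderiv ℝ (fderiv ℝ H) x a a
      = fderiv ℝ (fderiv ℝ H) x (a - ⟪x, a⟫ • x) (a - ⟪x, a⟫ • x) := by
    simp [h1, h2]
  rw [h3]
  refine hpos x hx1 _ ?_ ?_
  · rw [inner_sub_right, real_inner_smul_right, real_inner_self_eq_norm_sq, hx1]
    ring
  · intro h0
    refine ha (⟪x, a⟫ * ‖y‖⁻¹) ?_
    rw [mul_smul, ← hx]
    exact sub_eq_zero.1 h0

theorem hess_nonneg {y : E} (hy : y ≠ 0) (a : E) : 0 ≤ fderiv ℝ (fderiv ℝ H) y a a := by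
  by_cases ha : ∃ c : ℝ, a = c • y
  · obtain ⟨c, rfl⟩ := ha
    simp [hH.fderiv_fderiv_apply_self hy]
  · push Not at ha
    exact (hH.hess_pos hpos hy ha).le

/-- The strict supporting hyperplane inequality: `H` lies above its linearization at `z`. It is
obtained by integrating the Hessian along the segment from `z` to `y`, which misses the origin. -/
theorem fderiv_apply_lt {y z : E} (hz : z ≠ 0) (hyz : ∀ c : ℝ, y ≠ c • z) :
    fderiv ℝ H z y < H y := by
  have hne : ∀ t : ℝ, z + t • (y - z) ≠ 0 := by
    intro t h0
    by_cases ht : t = 0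
    · exact hz (by simpa [ht] using h0)
    · refine hyz (-t⁻¹ * (1 - t)) ?_
      have h1 : t • y = (-(1 - t)) • z := by
        rw [← sub_eq_zero, ← h0]
        module
      rw [neg_mul_comm, mul_smul, ← h1, smul_smul, inv_mul_cancel₀ ht, one_smul]
  have hnp : ∀ t c : ℝ, y - z ≠ c • (z + t • (y - z)) := by
    intro t c h0
    have h1 : (1 - c * t) • y = (1 + c - c * t) • z := by
      rw [← sub_eq_zero] at h0 ⊢
      rw [← h0]
      module
    by_cases hct : 1 - c * t = 0
    · rw [hct, zero_smul, show 1 + c - c * t = c by linarith] at h1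
      have hc : c ≠ 0 := by
        rintro rfl
        simp at hct
      exact (smul_ne_zero hc hz) h1.symm
    · refine hyz ((1 - c * t)⁻¹ * (1 + c - c * t)) ?_
      rw [mul_smul, ← h1, smul_smul, inv_mul_cancel₀ hct, one_smul]
  have hmono : StrictMonoOn (fun t : ℝ => fderiv ℝ H (z + t • (y - z)) (y - z)) (Set.Icc 0 1) := by
    refine strictMonoOn_of_deriv_pos (convex_Icc 0 1) (fun t _ =>
      (hH.hasDerivAt_fderiv_line_apply (hne t) _).continuousAt.continuousWithinAt) fun t _ => ?_
    rw [(hH.hasDerivAt_fderiv_line_apply (hne t) _).deriv]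
    exact hH.hess_pos hpos (hne t) (hnp t)
  obtain ⟨c, hc, hmv⟩ := exists_hasDerivAt_eq_slope (fun t : ℝ => H (z + t • (y - z)))
    (fun t : ℝ => fderiv ℝ H (z + t • (y - z)) (y - z)) zero_lt_one
    (fun t _ => (hH.hasDerivAt_line (hne t)).continuousAt.continuousWithinAt)
    fun t _ => hH.hasDerivAt_line (hne t)
  have h2 := hmono (Set.left_mem_Icc.2 zero_le_one) (Set.Ioo_subset_Icc_self hc) hc.1
  simp only [hmv] at h2
  simp only [zero_smul, add_zero, map_sub, hH.fderiv_apply_self hz, one_smul, sub_zero,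
    div_one, add_sub_cancel] at h2
  linarith

/-- An even convex function is positive: `H` lies above its linearization at a point `z` orthogonal to
`y`, both at `y` and at `-y`. -/
theorem pos_of_even (heven : ∀ y, H (-y) = H y) {y z : E} (hz : z ≠ 0) (hy : y ≠ 0)
    (hyz : ⟪y, z⟫ = 0) : 0 < H y := by
  have hne : ∀ w : E, w ≠ 0 → ⟪w, z⟫ = 0 → ∀ c : ℝ, w ≠ c • z := by
    rintro w hw hwz c rfl
    rw [real_inner_smul_left, mul_eq_zero, inner_self_eq_zero] at hwz
    rcases hwz with h | h
    · exact hw (by rw [h, zero_smul])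
    · exact hz h
  have h1 := hH.fderiv_apply_lt hpos hz (hne y hy hyz)
  have h2 := hH.fderiv_apply_lt hpos hz (hne (-y) (neg_ne_zero.2 hy) (by simp [hyz]))
  rw [heven, map_neg] at h2
  linarith

end SmoothHomogeneous

namespace SmoothHomogeneous

variable {H : E → ℝ} (hH : SmoothHomogeneous H)
include hH

/-- The second derivative test at a maximum of `H` on the unit sphere. -/
theorem hess_le_of_isMax {x a : E} {c : ℝ} (hx : ‖x‖ = 1) (ha : ‖a‖ = 1) (hxa : ⟪x, a⟫ = 0)
    (hle : ∀ y, H y ≤ c * ‖y‖) (heq : H x = c) : fderiv ℝ (fderiv ℝ H) x a a ≤ c := by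
  have hy := line_ne_zero hx ha hxa
  have hs : ∀ t : ℝ, HasDerivAt (fun t : ℝ => √(1 + t ^ 2)) (t / √(1 + t ^ 2)) t := by
    intro t
    have h1 : HasDerivAt (fun t : ℝ => 1 + t ^ 2) (2 * t) t := by
      simpa using (hasDerivAt_pow 2 t).const_add 1
    refine (h1.sqrt (by positivity)).congr_deriv ?_
    field_simp
  have hs2 : HasDerivAt (fun t : ℝ => t / √(1 + t ^ 2)) 1 0 := by
    have h := HasDerivAt.fun_div (c := fun t : ℝ => t) (hasDerivAt_id' (0 : ℝ)) (hs 0) (by simp)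
    simpa using h
  have h1 : ∀ t, HasDerivAt (fun t : ℝ => H (x + t • a) - c * √(1 + t ^ 2))
      (fderiv ℝ H (x + t • a) a - c * (t / √(1 + t ^ 2))) t := fun t =>
    (hH.hasDerivAt_line (hy t)).sub ((hs t).const_mul c)
  have h2 : HasDerivAt (fun t : ℝ => fderiv ℝ H (x + t • a) a - c * (t / √(1 + t ^ 2)))
      (fderiv ℝ (fderiv ℝ H) x a a - c * 1) 0 := by
    have := (hH.hasDerivAt_fderiv_line_apply (hy 0) a).fun_sub (hs2.const_mul c)
    simpa using this
  have h3 := nonpos_of_isLocalMax_of_hasDerivAt h1 h2 (.of_forall fun t => by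
    have := hle (x + t • a)
    rw [norm_line hx ha hxa] at this
    simp only [zero_smul, add_zero, heq]
    norm_num
    exact this)
  linarith

theorem neg : SmoothHomogeneous (fun y => - H y) where
  contDiffAt y hy := (hH.contDiffAt y hy).neg
  map_smul c hc y := by rw [hH.map_smul c hc]; ring

theorem le_hess_of_isMin {x a : E} {c : ℝ} (hx : ‖x‖ = 1) (ha : ‖a‖ = 1) (hxa : ⟪x, a⟫ = 0)
    (hle : ∀ y, c * ‖y‖ ≤ H y) (heq : H x = c) : c ≤ fderiv ℝ (fderiv ℝ H) x a a := by
  have h := hH.neg.hess_le_of_isMax (c := -c) hx ha hxa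
    (fun y => by have := hle y; linarith) (by rw [heq])
  have h1 : fderiv ℝ (fun y => - H y) = fun y => - fderiv ℝ H y := by
    funext y
    exact fderiv_fun_neg
  rw [h1, fderiv_fun_neg] at h
  simp only [neg_apply] at h
  linarith

/-- The second order condition, in the tangential direction `a`, at a point `x` of the unit sphere
where `|∇h| / h ^ α` is maximal with value `K`; here `e` is the direction of the gradient and `s` its
length. The vector `e - t ⟪a, e⟫ x` is orthogonal to `x + t a`, so the bound for `|∇h|` applies to
the derivative in its direction, with equality at `t = 0`. -/
theorem third_fderiv_le_of_isMax_grad {x e a : E} {α K s : ℝ} (hx : ‖x‖ = 1) (he : ‖e‖ = 1)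
    (ha : ‖a‖ = 1) (hxe : ⟪x, e⟫ = 0) (hxa : ⟪x, a⟫ = 0) (hpos : ∀ y, y ≠ 0 → 0 < H y)
    (hgrad : ∀ v, ⟪x, v⟫ = 0 → fderiv ℝ H x v = s * ⟪v, e⟫)
    (hs : s = K * H x ^ α)
    (hmax : ∀ y, y ≠ 0 → ∀ w, ⟪w, y⟫ = 0 → fderiv ℝ H y w ≤ K * (‖w‖ * (H y / ‖y‖) ^ α)) :
    fderiv ℝ (fderiv ℝ (fderiv ℝ H)) x e a a ≤
      α * (s / H x) * (fderiv ℝ (fderiv ℝ H) x a a - H x)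
        + ⟪a, e⟫ ^ 2 * s * (1 - α * (1 - α) * (s / H x) ^ 2) := by
  have hy := line_ne_zero hx ha hxa
  have hx0 : x ≠ 0 := by simpa using hy 0
  have hHx := hpos x hx0
  set β := ⟪a, e⟫ with hβ
  have hg : ∀ t : ℝ, 0 < H (x + t • a) := fun t => hpos _ (hy t)
  -- the logarithm of the comparison function and its first derivative
  set L : ℝ → ℝ := fun t => Real.log (1 + t ^ 2 * β ^ 2) / 2 + α * Real.log (H (x + t • a))
    - α * (Real.log (1 + t ^ 2) / 2) with hL
  set L' : ℝ → ℝ := fun t => t * β ^ 2 / (1 + t ^ 2 * β ^ 2)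
    + α * (fderiv ℝ H (x + t • a) a / H (x + t • a)) - α * (t / (1 + t ^ 2)) with hL'
  have hlog : ∀ c t : ℝ, HasDerivAt (fun t : ℝ => Real.log (1 + t ^ 2 * c ^ 2) / 2)
      (t * c ^ 2 / (1 + t ^ 2 * c ^ 2)) t := by
    intro c t
    have h1 : HasDerivAt (fun t : ℝ => 1 + t ^ 2 * c ^ 2) (2 * t * c ^ 2) t := by
      simpa using ((hasDerivAt_pow 2 t).mul_const (c ^ 2)).const_add 1
    refine ((h1.log (by positivity)).div_const 2).congr_deriv ?_
    ring
  have hlog2 : ∀ c : ℝ, HasDerivAt (fun t : ℝ => t * c ^ 2 / (1 + t ^ 2 * c ^ 2)) (c ^ 2) 0 := by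
    intro c
    have h1 : HasDerivAt (fun t : ℝ => 1 + t ^ 2 * c ^ 2) 0 0 := by
      simpa using ((hasDerivAt_pow 2 (0 : ℝ)).mul_const (c ^ 2)).const_add 1
    simpa using ((hasDerivAt_id' (0 : ℝ)).mul_const (c ^ 2)).fun_div h1 (by simp)
  have hLd : ∀ t, HasDerivAt L (L' t) t := by
    intro t
    have h1 := hlog 1 t
    simp only [one_pow, mul_one] at h1
    exact ((hlog β t).add (((hH.hasDerivAt_line (hy t)).log (hg t).ne').const_mul α)).sub
      (h1.const_mul α)
  set q := fderiv ℝ (fderiv ℝ H) x a a with hq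
  have hgx : fderiv ℝ H x a = s * β := hgrad a hxa
  have hLd2 : HasDerivAt L' (β ^ 2 + α * ((q * H x - s * β * (s * β)) / H x ^ 2) - α) 0 := by
    have h1 := hlog2 1
    simp only [one_pow, mul_one] at h1
    have h2 := (hH.hasDerivAt_fderiv_line_apply (hy 0) a).div (hH.hasDerivAt_line (hy 0)) (hg 0).ne'
    simp only [zero_smul, add_zero, hgx] at h2
    have h3 := ((hlog2 β).add (h2.const_mul α)).sub (h1.const_mul α)
    rw [mul_one] at h3
    exact h3
  have hL0 : Real.exp (L 0) = H x ^ α := by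
    simp [hL, Real.rpow_def_of_pos hHx, mul_comm]
  have hL'0 : L' 0 = α * (s * β / H x) := by
    simp [hL', hgx]
  have hexp : ∀ t, Real.exp (L t) =
      ‖e - (t * β) • x‖ * (H (x + t • a) / ‖x + t • a‖) ^ α := by
    intro t
    have hn1 : ‖e - (t * β) • x‖ = Real.exp (Real.log (1 + t ^ 2 * β ^ 2) / 2) := by
      have : ‖e - (t * β) • x‖ ^ 2 = 1 + t ^ 2 * β ^ 2 := by
        rw [norm_sub_sq_real, real_inner_smul_right, real_inner_comm, hxe, norm_smul, he, hx,
          Real.norm_eq_abs, mul_one, sq_abs]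
        ring
      rw [← this, Real.log_pow]
      have hne : ‖e - (t * β) • x‖ ≠ 0 := by
        intro h0
        rw [h0] at this
        nlinarith [sq_nonneg (t * β)]
      rw [Nat.cast_ofNat, mul_div_cancel_left₀ _ two_ne_zero,
        Real.exp_log (lt_of_le_of_ne (norm_nonneg _) hne.symm)]
    have hn2 : (H (x + t • a) / ‖x + t • a‖) ^ α
        = Real.exp (α * Real.log (H (x + t • a)) - α * (Real.log (1 + t ^ 2) / 2)) := by
      have hn : 0 < ‖x + t • a‖ := norm_pos_iff.2 (hy t)
      rw [Real.rpow_def_of_pos (div_pos (hg t) hn), Real.log_div (hg t).ne' hn.ne',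
        ← norm_sq_line hx ha hxa t, Real.log_pow]
      congr 1
      push_cast
      ring
    rw [hn1, hn2, ← Real.exp_add]
    congr 1
    simp only [hL]
    ring
  -- the function with a maximum at `t = 0`
  have hw : ∀ t : ℝ, HasDerivAt (fun t : ℝ => e - (t * β) • x) (-(β • x)) t := by
    intro t
    simpa using (((hasDerivAt_id t).mul_const β).smul_const x).const_sub e
  have h1 : ∀ t, HasDerivAt
      (fun t : ℝ => fderiv ℝ H (x + t • a) (e - (t * β) • x) - K * Real.exp (L t))
      (fderiv ℝ (fderiv ℝ H) (x + t • a) a (e - (t * β) • x)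
        + fderiv ℝ H (x + t • a) (-(β • x)) - K * (Real.exp (L t) * L' t)) t := fun t =>
    ((hH.hasDerivAt_fderiv_line (hy t)).clm_apply (hw t)).sub ((hLd t).exp.const_mul K)
  have h2 : HasDerivAt (fun t : ℝ => fderiv ℝ (fderiv ℝ H) (x + t • a) a (e - (t * β) • x)
        + fderiv ℝ H (x + t • a) (-(β • x)) - K * (Real.exp (L t) * L' t)) _ 0 :=
    ((((hH.hasDerivAt_fderiv_fderiv_line (hy 0)).clm_apply (hasDerivAt_const 0 a)).clm_apply
      (hw 0)).add (hH.hasDerivAt_fderiv_line_apply (hy 0) (-(β • x)))).sub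
      (((hLd 0).exp.mul hLd2).const_mul K)
  have h3 := nonpos_of_isLocalMax_of_hasDerivAt h1 h2 (.of_forall fun t => by
    have horth : ⟪e - (t * β) • x, x + t • a⟫ = 0 := by
      rw [inner_sub_left, inner_add_right, inner_add_right, real_inner_smul_left,
        real_inner_smul_left, real_inner_smul_right, real_inner_smul_right, hxa,
        real_inner_self_eq_norm_sq, hx, real_inner_comm, hxe, real_inner_comm, ← hβ]
      ring
    have h4 := hmax _ (hy t) _ horth
    have h5 := hgrad e hxe
    rw [real_inner_self_eq_norm_sq, he] at h5
    rw [← hexp] at h4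
    simp only [zero_mul, zero_smul, add_zero, sub_zero, hL0, h5]
    rw [hs]
    linarith)
  have h6 : fderiv ℝ (fderiv ℝ H) x a (β • x) = 0 := by
    rw [ContinuousLinearMap.map_smul, hH.fderiv_fderiv_comm hx0, hH.fderiv_fderiv_apply_self hx0]
    simp
  simp only [zero_mul, zero_smul, add_zero, sub_zero, map_neg, h6, hL0, hL'0,
    map_zero, neg_zero] at h3
  rw [hH.third_fderiv_comm hx0]
  have h7 : K * (H x ^ α * (α * (s * β / H x)) * (α * (s * β / H x))
      + H x ^ α * (β ^ 2 + α * ((q * H x - s * β * (s * β)) / H x ^ 2) - α))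
      = α * (s / H x) * (q - H x) + β ^ 2 * s * (1 - α * (1 - α) * (s / H x) ^ 2) := by
    have h8 : ∀ u v w : ℝ, K * (H x ^ α * u * v + H x ^ α * w) = K * H x ^ α * (u * v + w) :=
      fun u v w => by ring
    rw [h8, ← hs]
    field_simp
    ring
  linarith

end SmoothHomogeneous

end Convex

/-! ### The gradient estimate -/

variable {n : ℕ}

section Bridge

variable {h : Sph n → ℝ} (hh : ContMDiff (𝓡 n) 𝓘(ℝ, ℝ) ∞ h)
include hh

theorem isSymmetric_radiiOp (x : Sph n) :
    (radiiOp h x : Tan x →ₗ[ℝ] Tan x).IsSymmetric := by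
  intro a b
  have h1 := fderiv_fderiv_homExt_coe hh x a b
  have h2 := fderiv_fderiv_homExt_coe hh x b a
  rw [(smoothHomogeneous_homExt hh).fderiv_fderiv_comm (coe_ne_zero x), h1] at h2
  exact h2.trans (real_inner_comm a (radiiOp h x b))

omit hh in
theorem finrank_tan (x : Sph n) : Module.finrank ℝ (Tan x) = n := by
  have := Fact.mk (@finrank_euclideanSpace_fin ℝ _ (n + 1))
  exact Submodule.finrank_orthogonal_span_singleton (coe_ne_zero x)

theorem tangentiallyPosDef_homExt (hconv : StrictlyConvex h) : TangentiallyPosDef (homExt h) := by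
  intro x hx a hxa ha
  let y : Sph n := ⟨x, by simpa using hx⟩
  let b : Tan y := ⟨a, Submodule.mem_orthogonal_singleton_iff_inner_right.2 hxa⟩
  have h1 := fderiv_fderiv_homExt_coe hh y b b
  have h2 : b ≠ 0 := fun h0 => ha (congrArg Subtype.val h0)
  have h3 := inner_pos_of_sigma_pos (finrank_tan y) (isSymmetric_radiiOp hh y)
    (fun i hi hin => hconv y i hi hin) h2
  rw [← h1] at h3
  exact h3

/-- The `σ_k` of the radii of curvature, as a function of the full Hessian of the homogeneous
extension in a fixed basis of `ℝⁿ⁺¹`. -/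
theorem matSigma_hess_eq {ι : Type*} [Fintype ι] [DecidableEq ι]
    (b : OrthonormalBasis ι ℝ (Euc n)) {k : ℕ} (hk : k ≤ n) (x : Sph n) :
    matSigma k (Matrix.of fun i j => fderiv ℝ (fderiv ℝ (homExt h)) x (b i) (b j))
      = sigma k (radiiOp h x) := by
  have hH := smoothHomogeneous_homExt hh
  have hx := coe_ne_zero x
  have hself := hH.fderiv_fderiv_apply_self hx
  set A : Euc n →L[ℝ] Euc n :=
    (rieszCLM (Euc n)).comp (fderiv ℝ (fderiv ℝ (homExt h)) (x : Euc n)) with hA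
  have hAi : ∀ a v, ⟪A a, v⟫ = fderiv ℝ (fderiv ℝ (homExt h)) x a v := fun a v =>
    inner_rieszCLM _ _
  rw [← matSigma_eq_sigma_restrict b finrank_euclideanSpace_fin hk (A := A) hx (by simp [hA, hself])
    (isSymmetric_radiiOp hh x)]
  · congr 1
    ext i j
    simp only [Matrix.of_apply]
    rw [real_inner_comm, hAi, hH.fderiv_fderiv_comm hx]
  · intro a
    refine ext_inner_right ℝ fun v => ?_
    have hxa : ⟪(x : Euc n), (radiiOp h x a : Euc n)⟫ = 0 :=
      Submodule.mem_orthogonal_singleton_iff_inner_right.1 (radiiOp h x a).2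
    have hv : v - ⟪(x : Euc n), v⟫ • (x : Euc n) ∈ Tan x := by
      rw [Submodule.mem_orthogonal_singleton_iff_inner_right, inner_sub_right,
        real_inner_smul_right, real_inner_self_eq_norm_sq, norm_coe]
      ring
    have h1 := fderiv_fderiv_homExt_coe hh x a ⟨_, hv⟩
    rw [Submodule.coe_inner] at h1
    simp only [map_sub, map_smul, inner_sub_right, real_inner_smul_right] at h1
    rw [hH.fderiv_fderiv_comm hx (a : Euc n) (x : Euc n), hself,
      real_inner_comm (x : Euc n) (radiiOp h x a : Euc n), hxa] at h1
    rw [hAi]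
    simpa using h1.symm

omit hh in
theorem homExt_neg (heven : ∀ x, h (-x) = h x) (y : Euc n) : homExt h (-y) = homExt h y := by
  by_cases hy : y = 0
  · simp [hy]
  · rw [homExt_eq h (neg_ne_zero.2 hy), homExt_eq h hy, norm_neg, ← heven (toSph y hy)]
    congr 2
    apply Subtype.ext
    simp [toSph]

theorem homExt_pos (hn : 1 ≤ n) (heven : ∀ x, h (-x) = h x) (hconv : StrictlyConvex h) {y : Euc n}
    (hy : y ≠ 0) : 0 < homExt h y := by
  have hfin : Module.finrank ℝ (ℝ ∙ y)ᗮ = n := by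
    have := Fact.mk (@finrank_euclideanSpace_fin ℝ _ (n + 1))
    exact Submodule.finrank_orthogonal_span_singleton hy
  have : Nontrivial (ℝ ∙ y)ᗮ := Module.nontrivial_of_finrank_pos (R := ℝ) (by omega)
  obtain ⟨z, hz⟩ := exists_ne (0 : (ℝ ∙ y)ᗮ)
  exact (smoothHomogeneous_homExt hh).pos_of_even (tangentiallyPosDef_homExt hh hconv)
    (homExt_neg heven) (fun h0 => hz (Subtype.ext h0)) hy
    (Submodule.mem_orthogonal_singleton_iff_inner_right.1 z.2)

theorem pos_of_strictlyConvex (hn : 1 ≤ n) (heven : ∀ x, h (-x) = h x) (hconv : StrictlyConvex h)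
    (x : Sph n) : 0 < h x := by
  rw [← homExt_coe h x]
  exact homExt_pos hh hn heven hconv (coe_ne_zero x)

theorem rieszCLM_fderiv_homExt (x : Sph n) :
    rieszCLM (Euc n) (fderiv ℝ (homExt h) x) = sphGrad h x + h x • (x : Euc n) :=
  ext_inner_right ℝ fun v => by
    rw [inner_rieszCLM, fderiv_homExt_coe (hh.of_le (by simp))]

theorem norm_sq_rieszCLM_fderiv_homExt (x : Sph n) :
    ‖rieszCLM (Euc n) (fderiv ℝ (homExt h) x)‖ ^ 2 = h x ^ 2 + ‖sphGrad h x‖ ^ 2 := by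
  rw [rieszCLM_fderiv_homExt hh, norm_add_sq_real, real_inner_smul_right,
    inner_sphGrad_coe (hh.of_le (by simp)), norm_smul, norm_coe, Real.norm_eq_abs, mul_one, sq_abs]
  ring

omit hh in
theorem fderiv_homExt_le (hh : ContMDiff (𝓡 n) 𝓘(ℝ, ℝ) ∞ h) {K α : ℝ}
    (hmax : ∀ y : Sph n, ‖sphGrad h y‖ ≤ K * h y ^ α) {y : Euc n} (hy : y ≠ 0) {w : Euc n}
    (hwy : ⟪w, y⟫ = 0) :
    fderiv ℝ (homExt h) y w ≤ K * (‖w‖ * (homExt h y / ‖y‖) ^ α) := by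
  have hH := smoothHomogeneous_homExt hh
  have hn : 0 < ‖y‖ := norm_pos_iff.2 hy
  have h1 : fderiv ℝ (homExt h) y = fderiv ℝ (homExt h) (toSph y hy : Euc n) :=
    (hH.fderiv_smul hy (inv_pos.2 hn)).symm
  have h2 : homExt h y / ‖y‖ = h (toSph y hy) := by
    rw [homExt_eq h hy]
    field_simp
  have h3 : ⟪(toSph y hy : Euc n), w⟫ = 0 := by
    simp only [toSph]
    rw [real_inner_smul_left, real_inner_comm, hwy, mul_zero]
  rw [h1, h2, fderiv_homExt_coe (hh.of_le (by simp)), inner_add_left, real_inner_smul_left, h3,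
    mul_zero, add_zero]
  calc ⟪sphGrad h (toSph y hy), w⟫ ≤ ‖sphGrad h (toSph y hy)‖ * ‖w‖ := real_inner_le_norm _ _
    _ ≤ K * h (toSph y hy) ^ α * ‖w‖ := by gcongr; exact hmax _
    _ = _ := by ring

end Bridge

section GradientEstimate

variable {h : Sph n → ℝ}

/-- The maximum principle for `|∇h| / h ^ α`: where it is maximal, `σ_k` grows in the direction of
the gradient at most at the logarithmic rate `α k |∇h| / h`, unless `|∇h| / h` is bounded in terms
of `α`. -/
theorem exists_hasDerivAt_matSigma_hess_le (hn : 1 ≤ n)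
    (hh : ContMDiff (𝓡 n) 𝓘(ℝ, ℝ) ∞ h) (heven : ∀ x, h (-x) = h x) (hconv : StrictlyConvex h)
    {k : ℕ} (hk : k ≤ n) {α K s : ℝ} (hα : 0 < α) (x : Sph n) {e : Euc n}
    (he : ‖e‖ = 1) (hs : 0 < s) (hgrad : sphGrad h x = s • e) (hsK : s = K * h x ^ α)
    (hmax : ∀ y, ‖sphGrad h y‖ ≤ K * h y ^ α) (hlarge : 1 ≤ α * (1 - α) * (s / h x) ^ 2)
    {c : ℝ → Sph n} (hc0 : c 0 = x) (hc : HasDerivAt (fun t => (c t : Euc n)) e 0) :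
    ∃ D, HasDerivAt (fun t => sigma k (radiiOp h (c t))) D 0 ∧
      D ≤ α * (s / h x) * (k * sigma k (radiiOp h x)) := by
  have hH := smoothHomogeneous_homExt hh
  have hpd := tangentiallyPosDef_homExt hh hconv
  have hx := coe_ne_zero x
  have hx1 := norm_coe x
  have hhx := pos_of_strictlyConvex hh hn heven hconv x
  have hxe : ⟪(x : Euc n), e⟫ = 0 := by
    have h1 := inner_sphGrad_coe (hh.of_le (by simp)) x
    rw [hgrad, real_inner_smul_left, mul_eq_zero, real_inner_comm] at h1
    exact h1.resolve_left hs.ne'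
  have hself := hH.fderiv_fderiv_apply_self hx
  -- an orthonormal basis of eigenvectors of the full Hessian
  set A : Euc n →L[ℝ] Euc n :=
    (rieszCLM (Euc n)).comp (fderiv ℝ (fderiv ℝ (homExt h)) (x : Euc n)) with hA
  have hAi : ∀ a v, ⟪A a, v⟫ = fderiv ℝ (fderiv ℝ (homExt h)) x a v := fun a v =>
    inner_rieszCLM _ _
  have hAs : (A : Euc n →ₗ[ℝ] Euc n).IsSymmetric := by
    intro a b
    have h1 := hAi a b
    have h2 := hAi b a
    exact (h1.trans ((hH.fderiv_fderiv_comm hx a b).trans h2.symm)).trans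
      (real_inner_comm a (A b))
  have hfin : Module.finrank ℝ (Euc n) = n + 1 := finrank_euclideanSpace_fin
  set b := hAs.eigenvectorBasis hfin with hb
  set d := hAs.eigenvalues hfin with hd
  have hAb : ∀ i, A (b i) = d i • b i := fun i => hAs.apply_eigenvectorBasis hfin i
  have hbij : ∀ i j, fderiv ℝ (fderiv ℝ (homExt h)) x (b i) (b j) = if i = j then d i else 0 := by
    intro i j
    rw [← hAi, hAb, real_inner_smul_left, b.inner_eq_ite]
    simp
  have hdi : ∀ i, fderiv ℝ (fderiv ℝ (homExt h)) x (b i) (b i) = d i := fun i => by simp [hbij]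
  have hdnn : ∀ i, 0 ≤ d i := fun i => by
    rw [← hdi]
    exact hH.hess_nonneg hpd hx _
  have hM : ∀ i j, HasDerivAt (fun t => (Matrix.of fun i j =>
      fderiv ℝ (fderiv ℝ (homExt h)) (c t : Euc n) (b i) (b j)) i j)
      ((Matrix.of fun i j =>
        fderiv ℝ (fderiv ℝ (fderiv ℝ (homExt h))) (x : Euc n) e (b i) (b j)) i j) 0 := by
    intro i j
    have h1 : HasDerivAt (fun t => fderiv ℝ (fderiv ℝ (homExt h)) (c t : Euc n))
        (fderiv ℝ (fderiv ℝ (fderiv ℝ (homExt h))) (x : Euc n) e) 0 :=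
      HasFDerivAt.comp_hasDerivAt_of_eq (l := fderiv ℝ (fderiv ℝ (homExt h))) 0
        (hH.hasFDerivAt_fderiv_fderiv hx) hc (by rw [hc0])
    simpa using (h1.clm_apply (hasDerivAt_const 0 (b i))).clm_apply (hasDerivAt_const 0 (b j))
  obtain ⟨D, hD, hle⟩ := exists_hasDerivAt_matSigma_le (k := k) (κ := α * (s / h x))
    (by rw [Fintype.card_fin]; omega) hdnn hM (by
      ext i j
      simp [hc0, hbij, Matrix.diagonal_apply]) (by
    intro i
    simp only [Matrix.of_apply]
    by_cases hi : ⟪(x : Euc n), b i⟫ = 0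
    · have h1 := hH.third_fderiv_le_of_isMax_grad (K := K) (s := s) (α := α) hx1 he
        (b.norm_eq_one i) hxe hi (fun y hy => homExt_pos hh hn heven hconv hy)
        (fun v hv => by
          rw [fderiv_homExt_coe (hh.of_le (by simp)), inner_add_left, real_inner_smul_left, hv,
            hgrad, real_inner_smul_left, real_inner_comm]
          ring)
        (by rw [homExt_coe, hsK]) (fun y hy w hw => fderiv_homExt_le hh hmax hy hw)
      rw [homExt_coe, hdi] at h1
      have h2 : ⟪b i, e⟫ ^ 2 * s * (1 - α * (1 - α) * (s / h x) ^ 2) ≤ 0 :=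
        mul_nonpos_of_nonneg_of_nonpos (by positivity) (by linarith)
      have h3 : α * (s / h x) * (d i - h x) ≤ α * (s / h x) * d i := by
        gcongr
        linarith
      linarith
    · -- an eigenvector that is not orthogonal to `x` is a multiple of `x`
      have h0 : d i = 0 := by
        have h1 : d i * ⟪(x : Euc n), b i⟫ = 0 := by
          rw [real_inner_comm, ← real_inner_smul_left, ← hAb, hAi,
            hH.fderiv_fderiv_comm hx, hself]
          rfl
        exact (mul_eq_zero.1 h1).resolve_right hi
      have h2 : ∃ r : ℝ, b i = r • (x : Euc n) := by
        by_contra hcon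
        push Not at hcon
        have := hH.hess_pos hpd hx hcon
        rw [hdi, h0] at this
        exact lt_irrefl _ this
      obtain ⟨r, hr⟩ := h2
      rw [h0, hr]
      simp [hH.third_fderiv_apply_self hx])
  simp only [matSigma_hess_eq hh b hk, hc0] at hD hle
  exact ⟨D, hD, hle⟩

/-- At a maximum of `|∇h| / h ^ α` the logarithmic gradient of a solution is bounded: there the
equation forces `σ_k` to grow along the gradient at the logarithmic rate `(p - 1) |∇h| / h`, up to
the logarithmic derivative of `f`. -/
theorem norm_sphGrad_le_of_isMax (hh : ContMDiff (𝓡 n) 𝓘(ℝ, ℝ) ∞ h) (heven : ∀ x, h (-x) = h x)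
    (hconv : StrictlyConvex h) {k : ℕ} (hk1 : 1 ≤ k) (hk : k ≤ n) {α K p q m A : ℝ} (hα : 0 < α)
    (hα1 : α < 1) (hm : 0 < m) (hA : 0 ≤ A) (hp : 2 * α * k ≤ p - 1) (hq : q ≤ (k : ℝ) + 1)
    {f : Sph n → ℝ} (hf : ContMDiff (𝓡 n) 𝓘(ℝ, ℝ) 2 f) (hfm : ∀ x, m ≤ f x)
    (hfA : ∀ x, ‖sphGrad f x‖ ≤ A) (hsol : IsSolution k p q f h) (x : Sph n)
    (hsK : ‖sphGrad h x‖ = K * h x ^ α) (hmax : ∀ y, ‖sphGrad h y‖ ≤ K * h y ^ α) :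
    ‖sphGrad h x‖ ≤ (1 / (α * (1 - α)) + A / (m * k * α)) * h x := by
  have hn : 1 ≤ n := hk1.trans hk
  have hk0 : (0 : ℝ) < k := by exact_mod_cast hk1
  have hhp := pos_of_strictlyConvex hh hn heven hconv
  have hhx := hhp x
  have h1α : 0 < α * (1 - α) := mul_pos hα (by linarith)
  by_contra hcon
  push Not at hcon
  set s := ‖sphGrad h x‖ with hsdef
  rw [← lt_div_iff₀ hhx] at hcon
  have hs1 : 1 / (α * (1 - α)) < s / h x := lt_of_le_of_lt (by
    have : 0 ≤ A / (m * k * α) := by positivity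
    linarith) hcon
  have hs2 : A / (m * k * α) < s / h x := lt_of_le_of_lt (by
    have : 0 ≤ 1 / (α * (1 - α)) := by positivity
    linarith) hcon
  have hs : 0 < s := by
    have : 0 < s / h x := lt_trans (by positivity) hs1
    exact (div_pos_iff_of_pos_right hhx).1 this
  have hlarge : 1 ≤ α * (1 - α) * (s / h x) ^ 2 := by
    have h1 : 1 < α * (1 - α) * (s / h x) := by
      rwa [div_lt_iff₀' h1α] at hs1
    have h2 : 1 ≤ s / h x := by nlinarith
    nlinarith
  obtain ⟨e, he⟩ : ∃ e : Euc n, e = s⁻¹ • sphGrad h x := ⟨_, rfl⟩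
  have he1 : ‖e‖ = 1 := by
    rw [he, norm_smul, norm_inv, Real.norm_of_nonneg hs.le, ← hsdef, inv_mul_cancel₀ hs.ne']
  have hgrad : sphGrad h x = s • e := by rw [he, smul_smul, mul_inv_cancel₀ hs.ne', one_smul]
  have hxe : ⟪(x : Euc n), e⟫ = 0 := by
    rw [he, real_inner_smul_right, real_inner_comm, inner_sphGrad_coe (hh.of_le (by simp)),
      mul_zero]
  -- the great circle through `x` in the direction of the gradient
  let c : ℝ → Sph n := fun t => ⟨Real.cos t • (x : Euc n) + Real.sin t • e, by
    rw [mem_sphere_zero_iff_norm, ← sq_eq_sq₀ (norm_nonneg _) zero_le_one, norm_add_sq_real,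
      norm_smul, norm_smul, real_inner_smul_left, real_inner_smul_right, hxe, norm_coe, he1,
      Real.norm_eq_abs, Real.norm_eq_abs, mul_one, mul_one, sq_abs, sq_abs]
    simp⟩
  have hc0 : c 0 = x := Subtype.ext (by simp [c])
  have hc0' : (x : Euc n) = (c 0 : Euc n) := by rw [hc0]
  have hc : HasDerivAt (fun t => (c t : Euc n)) e 0 := by
    have := ((Real.hasDerivAt_cos 0).smul_const (x : Euc n)).fun_add
      ((Real.hasDerivAt_sin 0).smul_const e)
    simpa using this
  obtain ⟨D, hD, hDle⟩ := exists_hasDerivAt_matSigma_hess_le hn hh heven hconv hk hα x he1 hs hgrad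
    hsK hmax hlarge hc0 hc
  -- the derivative of the right hand side of the equation
  have hH := smoothHomogeneous_homExt hh
  have hx := coe_ne_zero x
  have hfd : HasDerivAt (fun t => f (c t)) ⟪sphGrad f x, e⟫ 0 := by
    have h1 : HasDerivAt (fun t => radExt f (c t : Euc n)) ⟪sphGrad f x, e⟫ 0 := by
      rw [inner_sphGrad]
      exact HasFDerivAt.comp_hasDerivAt_of_eq (l := radExt f) 0
        ((contDiffAt_radExt hf hx).differentiableAt (by simp)).hasFDerivAt hc hc0'
    simpa only [radExt_coe] using h1
  have hhd : HasDerivAt (fun t => h (c t)) s 0 := by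
    have h1 : HasDerivAt (fun t => homExt h (c t : Euc n)) (fderiv ℝ (homExt h) x e) 0 :=
      HasFDerivAt.comp_hasDerivAt_of_eq (l := homExt h) 0 (hH.hasFDerivAt hx) hc hc0'
    rw [fderiv_homExt_coe (hh.of_le (by simp)), inner_add_left, real_inner_smul_left, hxe, hgrad,
      real_inner_smul_left, real_inner_self_eq_norm_sq, he1] at h1
    simpa only [homExt_coe, one_pow, mul_one, mul_zero, add_zero] using h1
  set w := fderiv ℝ (fderiv ℝ (homExt h)) x e e with hw
  have hw0 : 0 ≤ w := hH.hess_nonneg (tangentiallyPosDef_homExt hh hconv) hx e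
  have hrd : HasDerivAt (fun t => h (c t) ^ 2 + ‖sphGrad h (c t)‖ ^ 2) (2 * (s * w)) 0 := by
    have h1 : HasDerivAt (fun t => rieszCLM (Euc n) (fderiv ℝ (homExt h) (c t : Euc n)))
        (rieszCLM (Euc n) (fderiv ℝ (fderiv ℝ (homExt h)) x e)) 0 :=
      (rieszCLM (Euc n)).hasFDerivAt.comp_hasDerivAt 0
        (HasFDerivAt.comp_hasDerivAt_of_eq (l := fderiv ℝ (homExt h)) 0
          (hH.hasFDerivAt_fderiv hx) hc hc0')
    have h2 := h1.norm_sq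
    simp only [norm_sq_rieszCLM_fderiv_homExt hh] at h2
    refine h2.congr_deriv ?_
    rw [hc0, rieszCLM_fderiv_homExt hh, real_inner_comm, inner_rieszCLM, map_add, map_smul,
      hH.fderiv_fderiv_comm hx e (x : Euc n), hH.fderiv_fderiv_apply_self hx, hgrad, map_smul]
    simp [hw]
  have hrpos : 0 < h x ^ 2 + ‖sphGrad h x‖ ^ 2 := by positivity
  set r := h x ^ 2 + ‖sphGrad h x‖ ^ 2 with hr
  set ε := ((k : ℝ) + 1 - q) / 2 with hε
  have hε0 : 0 ≤ ε := by rw [hε]; linarith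
  have h1 := (hfd.fun_mul (hhd.rpow_const (p := p - 1) (Or.inl (hhp (c 0)).ne'))).fun_mul
    (hrd.rpow_const (p := ε) (Or.inl (by rw [hc0]; exact hrpos.ne')))
  have h2 : (fun t => sigma k (radiiOp h (c t))) = fun t =>
      f (c t) * h (c t) ^ (p - 1) * (h (c t) ^ 2 + ‖sphGrad h (c t)‖ ^ 2) ^ ε :=
    funext fun t => hsol (c t)
  rw [h2] at hD
  have hDeq := hD.unique h1
  simp only [hc0, ← hr] at hDeq
  have hfx : 0 < f x := hm.trans_le (hfm x)
  set P := h x ^ (p - 1) with hP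
  set R := r ^ ε with hR
  have hPpos : 0 < P := Real.rpow_pos_of_pos hhx _
  have hRpos : 0 < R := Real.rpow_pos_of_pos hrpos _
  have hsigma : sigma k (radiiOp h x) = f x * P * R := hsol x
  have hP' : h x ^ (p - 1 - 1) = P / h x := by rw [Real.rpow_sub_one hhx.ne']
  have hlow : f x * P * R * (-(A / m) + (p - 1) * (s / h x)) ≤ D := by
    rw [hDeq, hP']
    have h3 : 0 ≤ f x * P * (2 * (s * w) * ε * r ^ (ε - 1)) := by
      have := Real.rpow_nonneg hrpos.le (ε - 1)
      positivity
    have h4 : -(A / m) * f x ≤ ⟪sphGrad f x, e⟫ := by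
      have h5 : -A ≤ ⟪sphGrad f x, e⟫ := by
        have := abs_le.1 (abs_real_inner_le_norm (sphGrad f x) e)
        rw [he1, mul_one] at this
        have := hfA x
        linarith
      have h6 : A ≤ A / m * f x := by
        rw [div_mul_eq_mul_div, le_div_iff₀ hm]
        exact mul_le_mul_of_nonneg_left (hfm x) hA
      linarith
    have h5 := mul_le_mul_of_nonneg_right h4 (mul_pos hPpos hRpos).le
    have h6 : (⟪sphGrad f x, e⟫ * P + f x * (s * (p - 1) * (P / h x))) * R
        + f x * P * (2 * (s * w) * ε * r ^ (ε - 1)) - f x * P * R * (-(A / m) + (p - 1) * (s / h x))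
        = (⟪sphGrad f x, e⟫ * (P * R) - -(A / m) * f x * (P * R))
          + f x * P * (2 * (s * w) * ε * r ^ (ε - 1)) := by
      ring
    linarith
  rw [hsigma] at hDle
  have hfin : f x * P * R * (-(A / m) + (p - 1) * (s / h x))
      ≤ f x * P * R * (α * (s / h x) * k) := by linarith
  have h7 := le_of_mul_le_mul_left hfin (by positivity)
  have h8 : 0 < s / h x := by positivity
  have h9 : 2 * α * k * (s / h x) ≤ (p - 1) * (s / h x) := by gcongr
  have h10 : A / m < k * α * (s / h x) := by
    rw [div_lt_iff₀ (by positivity)] at hs2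
    rw [div_lt_iff₀ hm]
    linarith
  linarith

end GradientEstimate

/-! ### Bounds for the extreme values of a solution -/

theorem continuous_sphGrad {f : Sph n → ℝ} (hf : ContMDiff (𝓡 n) 𝓘(ℝ, ℝ) 1 f) :
    Continuous (sphGrad f) := by
  rw [continuous_iff_continuousAt]
  intro x
  have h1 : ContinuousAt (fderiv ℝ (radExt f)) (x : Euc n) :=
    ((contDiffAt_radExt hf (coe_ne_zero x)).fderiv_right (m := 0) (by simp)).continuousAt
  exact ((rieszCLM (Euc n)).continuous.continuousAt.comp h1).comp continuous_subtype_val.continuousAt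

theorem abs_le_and_norm_sphGrad_le_of_c2Norm_le {f : Sph n → ℝ}
    (hf : ContMDiff (𝓡 n) 𝓘(ℝ, ℝ) 1 f) {A : ℝ} (hA : c2Norm f ≤ A) (x : Sph n) :
    |f x| ≤ A ∧ ‖sphGrad f x‖ ≤ A := by
  have h1 : |f x| ≤ ⨆ x, |f x| :=
    le_ciSup (isCompact_range hf.continuous.abs).bddAbove x
  have h2 : ‖sphGrad f x‖ ≤ ⨆ x, ‖sphGrad f x‖ :=
    le_ciSup (isCompact_range (continuous_sphGrad hf).norm).bddAbove x
  have h3 : 0 ≤ ⨆ x, ‖sphHess f x‖ := Real.iSup_nonneg fun _ => ContinuousLinearMap.opNorm_nonneg _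
  unfold c2Norm at hA
  have := abs_nonneg (f x)
  have := norm_nonneg (sphGrad f x)
  constructor <;> linarith

section Estimates

variable {h : Sph n → ℝ} (hh : ContMDiff (𝓡 n) 𝓘(ℝ, ℝ) ∞ h)
include hh

/-- The gradient estimate `|∇h| ≤ C M ^ (1 - α) h ^ α`, where `M` is an upper bound for `h`. -/
theorem norm_sphGrad_le (heven : ∀ x, h (-x) = h x)
    (hconv : StrictlyConvex h) {k : ℕ} (hk1 : 1 ≤ k) (hk : k ≤ n) {α p q m A : ℝ} (hα : 0 < α)
    (hα1 : α < 1) (hm : 0 < m) (hA : 0 ≤ A) (hp : 2 * α * k ≤ p - 1) (hq : q ≤ (k : ℝ) + 1)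
    {f : Sph n → ℝ} (hf : ContMDiff (𝓡 n) 𝓘(ℝ, ℝ) 2 f) (hfm : ∀ x, m ≤ f x)
    (hfA : ∀ x, ‖sphGrad f x‖ ≤ A) (hsol : IsSolution k p q f h) {M : ℝ} (hM : ∀ x, h x ≤ M)
    (y : Sph n) :
    ‖sphGrad h y‖ ≤ (1 / (α * (1 - α)) + A / (m * k * α)) * M ^ (1 - α) * h y ^ α := by
  have hhp := pos_of_strictlyConvex hh (hk1.trans hk) heven hconv
  have hpow : ∀ x, 0 < h x ^ α := fun x => Real.rpow_pos_of_pos (hhp x) _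
  have hcont : Continuous fun x => ‖sphGrad h x‖ / h x ^ α :=
    (continuous_sphGrad (hh.of_le (by simp))).norm.div
      (hh.continuous.rpow_const fun x => Or.inl (hhp x).ne') fun x => (hpow x).ne'
  have : Nonempty (Sph n) := ⟨y⟩
  obtain ⟨x, hx⟩ := hcont.exists_forall_ge_of_hasCompactMulSupport (HasCompactMulSupport.of_compactSpace _)
  have hsK : ‖sphGrad h x‖ = ‖sphGrad h x‖ / h x ^ α * h x ^ α :=
    (div_mul_cancel₀ _ (hpow x).ne').symm
  have hmax : ∀ z, ‖sphGrad h z‖ ≤ ‖sphGrad h x‖ / h x ^ α * h z ^ α := fun z =>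
    (div_le_iff₀ (hpow z)).1 (hx z)
  have h1 := norm_sphGrad_le_of_isMax hh heven hconv hk1 hk hα hα1 hm hA hp hq hf hfm hfA hsol x
    hsK hmax
  have h1α : 0 < 1 - α := by linarith
  have hC : 0 ≤ 1 / (α * (1 - α)) + A / (m * k * α) := by positivity
  set C := 1 / (α * (1 - α)) + A / (m * k * α)
  refine (hmax y).trans (mul_le_mul_of_nonneg_right ?_ (hpow y).le)
  rw [div_le_iff₀ (hpow x)]
  refine h1.trans ?_
  rw [mul_assoc]
  refine mul_le_mul_of_nonneg_left ?_ hC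
  calc h x = h x ^ (1 - α) * h x ^ α := by
        rw [← Real.rpow_add (hhp x), sub_add_cancel, Real.rpow_one]
    _ ≤ M ^ (1 - α) * h x ^ α := by
        gcongr
        · exact (hpow x).le
        · exact (hhp x).le
        · exact hM x

omit hh in
theorem sphGrad_eq_zero_of_isExtr {x : Sph n} (hx : (∀ y, h y ≤ h x) ∨ ∀ y, h x ≤ h y) :
    sphGrad h x = 0 := by
  have h1 : IsLocalExtr (radExt h) (x : Euc n) := by
    rcases hx with hx | hx
    · right
      filter_upwards [isOpen_ne.mem_nhds (coe_ne_zero x)] with z hz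
      rw [radExt_eq h hz, radExt_coe]
      exact hx _
    · left
      filter_upwards [isOpen_ne.mem_nhds (coe_ne_zero x)] with z hz
      rw [radExt_eq h hz, radExt_coe]
      exact hx _
  refine ext_inner_right ℝ fun v => ?_
  rw [inner_sphGrad, h1.fderiv_eq_zero]
  simp

omit hh in
theorem homExt_le {M : ℝ} (hM : ∀ x, h x ≤ M) (y : Euc n) : homExt h y ≤ M * ‖y‖ := by
  by_cases hy : y = 0
  · simp [homExt, hy]
  · rw [homExt_eq h hy, mul_comm]
    gcongr
    exact hM _

omit hh in
theorem le_homExt {c : ℝ} (hc : ∀ x, c ≤ h x) (y : Euc n) : c * ‖y‖ ≤ homExt h y := by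
  by_cases hy : y = 0
  · simp [homExt, hy]
  · rw [homExt_eq h hy, mul_comm]
    gcongr
    exact hc _

/-- The quadratic form of `∇²h + h I` is determined by the Hessian of `H` on unit vectors. -/
theorem inner_radiiOp_self_scale (x : Sph n) {a : Tan x} (ha : a ≠ 0) :
    ∃ u : Euc n, ‖u‖ = 1 ∧ ⟪(x : Euc n), u⟫ = 0 ∧
      ⟪radiiOp h x a, a⟫ = fderiv ℝ (fderiv ℝ (homExt h)) x u u * ‖a‖ ^ 2 := by
  have hn : ‖a‖ ≠ 0 := norm_ne_zero_iff.2 ha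
  have hxa : ⟪(x : Euc n), (a : Euc n)⟫ = 0 :=
    Submodule.mem_orthogonal_singleton_iff_inner_right.1 a.2
  refine ⟨‖a‖⁻¹ • (a : Euc n), ?_, ?_, ?_⟩
  · rw [norm_smul, norm_inv, norm_norm]
    exact inv_mul_cancel₀ hn
  · rw [real_inner_smul_right, hxa, mul_zero]
  · rw [← fderiv_fderiv_homExt_coe hh x a a]
    simp only [map_smul, smul_apply, smul_eq_mul]
    field_simp

theorem sigma_le_of_isMax (hconv : StrictlyConvex h) (k : ℕ) {x : Sph n} (hx : ∀ y, h y ≤ h x) :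
    sigma k (radiiOp h x) ≤ n.choose k * h x ^ k := by
  refine sigma_le_of_inner_le (finrank_tan x) k (isSymmetric_radiiOp hh x) (fun a => ?_) fun a => ?_
  · rw [← fderiv_fderiv_homExt_coe hh x a a]
    exact (smoothHomogeneous_homExt hh).hess_nonneg (tangentiallyPosDef_homExt hh hconv)
      (coe_ne_zero x) _
  · by_cases ha : a = 0
    · simp [ha]
    · obtain ⟨u, hu, hxu, heq⟩ := inner_radiiOp_self_scale hh x ha
      rw [heq]
      gcongr
      exact (smoothHomogeneous_homExt hh).hess_le_of_isMax (norm_coe x) hu hxu (homExt_le hx)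
        (homExt_coe h x)

theorem le_sigma_of_isMin (k : ℕ) {x : Sph n} (hx0 : 0 ≤ h x) (hx : ∀ y, h x ≤ h y) :
    n.choose k * h x ^ k ≤ sigma k (radiiOp h x) := by
  refine le_sigma_of_le_inner (finrank_tan x) k (isSymmetric_radiiOp hh x) hx0 fun a => ?_
  by_cases ha : a = 0
  · simp [ha]
  · obtain ⟨u, hu, hxu, heq⟩ := inner_radiiOp_self_scale hh x ha
    rw [heq]
    gcongr
    exact (smoothHomogeneous_homExt hh).le_hess_of_isMin (norm_coe x) hu hxu (le_homExt hx)
      (homExt_coe h x)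

omit hh in
/-- The equation at an extremal point of `h`, where the gradient vanishes. -/
theorem sigma_eq_of_isExtr {k : ℕ} {p q : ℝ} {f : Sph n → ℝ} (hsol : IsSolution k p q f h)
    {x : Sph n} (hpos : 0 < h x) (hx : (∀ y, h y ≤ h x) ∨ ∀ y, h x ≤ h y) :
    sigma k (radiiOp h x) * h x ^ (q - p) = f x * h x ^ k := by
  rw [hsol x, sphGrad_eq_zero_of_isExtr hx, norm_zero]
  have h1 : (h x ^ 2 + 0 ^ 2) ^ (((k : ℝ) + 1 - q) / 2) = h x ^ ((k : ℝ) + 1 - q) := by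
    rw [zero_pow two_ne_zero, add_zero, ← Real.rpow_natCast, ← Real.rpow_mul hpos.le]
    congr 1
    push_cast
    ring
  rw [h1, mul_assoc, mul_assoc, ← Real.rpow_add hpos, ← Real.rpow_add hpos, ← Real.rpow_natCast]
  congr 2
  ring

theorem le_choose_mul_of_isMax (hconv : StrictlyConvex h) {k : ℕ} {p q m : ℝ} {f : Sph n → ℝ}
    (hfm : ∀ x, m ≤ f x) (hsol : IsSolution k p q f h) {x : Sph n} (hpos : 0 < h x)
    (hx : ∀ y, h y ≤ h x) : m ≤ n.choose k * h x ^ (q - p) := by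
  have h1 := sigma_eq_of_isExtr hsol hpos (Or.inl hx)
  have h2 := mul_le_mul_of_nonneg_right (sigma_le_of_isMax hh hconv k hx)
    (Real.rpow_nonneg hpos.le (q - p))
  have h3 : 0 < h x ^ k := by positivity
  refine (hfm x).trans (le_of_mul_le_mul_right ?_ h3)
  linarith

theorem choose_mul_le_of_isMin {k : ℕ} {p q A : ℝ} {f : Sph n → ℝ}
    (hfA : ∀ x, f x ≤ A) (hsol : IsSolution k p q f h) {x : Sph n} (hpos : 0 < h x)
    (hx : ∀ y, h x ≤ h y) : n.choose k * h x ^ (q - p) ≤ A := by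
  have h1 := sigma_eq_of_isExtr hsol hpos (Or.inr hx)
  have h2 := mul_le_mul_of_nonneg_right (le_sigma_of_isMin hh k hpos.le hx)
    (Real.rpow_nonneg hpos.le (q - p))
  have h3 : 0 < h x ^ k := by positivity
  refine le_trans (le_of_mul_le_mul_right ?_ h3) (hfA x)
  linarith

/-- The convex body with support function `h` contains the point `M v`, where `M = h v` is the
maximum of `h`. -/
theorem mul_inner_le_homExt (hconv : StrictlyConvex h) {v : Sph n} (hv : ∀ y, h y ≤ h v)
    {y : Euc n} (hyv : 0 ≤ ⟪y, (v : Euc n)⟫) : h v * ⟪y, (v : Euc n)⟫ ≤ homExt h y := by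
  have hH := smoothHomogeneous_homExt hh
  by_cases hc : ∃ c : ℝ, y = c • (v : Euc n)
  · obtain ⟨c, rfl⟩ := hc
    rw [real_inner_smul_left, real_inner_self_eq_norm_sq, norm_coe] at hyv ⊢
    rcases (by simpa using hyv : 0 ≤ c).eq_or_lt with h0 | h0
    · simp [← h0, homExt]
    · rw [hH.map_smul c h0, homExt_coe]
      linarith
  · push Not at hc
    have h1 := hH.fderiv_apply_lt (tangentiallyPosDef_homExt hh hconv) (coe_ne_zero v) hc
    rw [fderiv_homExt_coe (hh.of_le (by simp)), sphGrad_eq_zero_of_isExtr (Or.inl hv), zero_add,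
      real_inner_smul_left, real_inner_comm] at h1
    exact h1.le

/-- Noncollapsing: the gradient estimate makes `h ^ (1 - α)` Lipschitz, so a small minimum would
force `h` to grow slower than linearly near the minimum point, whereas the body contains the segment
from `-M v` to `M v`. The constant comes from the point at distance `t = (2 B) ^ (-1 / α)` of the
minimum point, where the Lipschitz bound accounts for half of the growth. -/
theorem mul_max_le_min (hn : 1 ≤ n) (heven : ∀ x, h (-x) = h x) (hconv : StrictlyConvex h)
    {α C : ℝ} (hα : 0 < α) (hα1 : α ≤ 1 / 2) (hC : 0 ≤ C) {v x : Sph n} (hv : ∀ y, h y ≤ h v)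
    (hgrad : ∀ y, ‖sphGrad h y‖ ≤ C * h v ^ (1 - α) * h y ^ α) :
    (1 / (2 * (C + 1))) ^ (1 / α) / 4 * h v ≤ h x := by
  have hhp := pos_of_strictlyConvex hh hn heven hconv
  -- by evenness, the maximum point can be taken in the hemisphere around `x`
  wlog hxv : 0 ≤ ⟪(x : Euc n), (v : Euc n)⟫ generalizing v
  · have h1 := this (v := -v) (fun y => by rw [heven]; exact hv y)
      (fun y => by rw [heven]; exact hgrad y) (by
        push Not at hxv
        simpa using hxv.le)
    rwa [heven] at h1
  have hH := smoothHomogeneous_homExt hh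
  set M := h v with hM
  have hMpos : 0 < M := hhp v
  have h1α : 0 < 1 - α := by linarith
  set B := C + 1 with hB
  have hBpos : 0 < B := by linarith
  set t₀ := (1 / (2 * B)) ^ (1 / α) with ht₀
  have ht₀pos : 0 < t₀ := by positivity
  have ht₀α : t₀ ^ α = 1 / (2 * B) := by
    rw [ht₀, ← Real.rpow_mul (by positivity), one_div_mul_cancel hα.ne', Real.rpow_one]
  have hnorm : ∀ t : ℝ, 0 ≤ t → 1 ≤ ‖(x : Euc n) + t • (v : Euc n)‖ := by
    intro t ht
    rw [← one_le_sq_iff₀ (norm_nonneg _), norm_add_sq_real, norm_coe, real_inner_smul_right]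
    have : 0 ≤ t * ⟪(x : Euc n), (v : Euc n)⟫ := mul_nonneg ht hxv
    nlinarith [sq_nonneg ‖t • (v : Euc n)‖]
  have hne : ∀ t : ℝ, 0 ≤ t → (x : Euc n) + t • (v : Euc n) ≠ 0 := fun t ht =>
    norm_pos_iff.1 (zero_lt_one.trans_le (hnorm t ht))
  have hGpos : ∀ t : ℝ, 0 ≤ t → 0 < homExt h ((x : Euc n) + t • (v : Euc n)) := fun t ht =>
    homExt_pos hh hn heven hconv (hne t ht)
  have hderiv : ∀ t : ℝ, 0 ≤ t → fderiv ℝ (homExt h) ((x : Euc n) + t • (v : Euc n)) v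
      ≤ B * M ^ (1 - α) * homExt h ((x : Euc n) + t • (v : Euc n)) ^ α := by
    intro t ht
    set y := (x : Euc n) + t • (v : Euc n) with hy
    have hy1 := hnorm t ht
    have hy0 := hne t ht
    have hsmul : fderiv ℝ (homExt h) y = fderiv ℝ (homExt h) (toSph y hy0 : Euc n) :=
      (hH.fderiv_smul hy0 (inv_pos.2 (norm_pos_iff.2 hy0))).symm
    set z := toSph y hy0
    have hz := hhp z
    have hzy : h z ≤ homExt h y := by
      rw [homExt_eq h hy0]
      exact le_mul_of_one_le_left hz.le hy1
    have hle : h z ≤ M ^ (1 - α) * h z ^ α := by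
      calc h z = h z ^ (1 - α) * h z ^ α := by
            rw [← Real.rpow_add hz, sub_add_cancel, Real.rpow_one]
        _ ≤ M ^ (1 - α) * h z ^ α := by
            gcongr
            exact hv z
    rw [hsmul, fderiv_homExt_coe (hh.of_le (by simp))]
    calc ⟪sphGrad h z + h z • (z : Euc n), (v : Euc n)⟫
        ≤ ‖sphGrad h z + h z • (z : Euc n)‖ * ‖(v : Euc n)‖ := real_inner_le_norm _ _
      _ ≤ (‖sphGrad h z‖ + h z) * 1 := by
          rw [norm_coe]
          gcongr
          refine (norm_add_le _ _).trans_eq ?_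
          rw [norm_smul, norm_coe, Real.norm_of_nonneg hz.le, mul_one]
      _ ≤ C * M ^ (1 - α) * h z ^ α + M ^ (1 - α) * h z ^ α := by
          rw [mul_one]
          exact add_le_add (hgrad z) hle
      _ = B * M ^ (1 - α) * h z ^ α := by rw [hB]; ring
      _ ≤ _ := by gcongr
  -- `G ^ (1 - α)` grows at most linearly along the segment from `x` in the direction of `v`
  have hanti : AntitoneOn (fun t : ℝ => homExt h ((x : Euc n) + t • (v : Euc n)) ^ (1 - α)
      - B * M ^ (1 - α) * t) (Set.Ici 0) := by
    have hd : ∀ t : ℝ, 0 ≤ t → HasDerivAt (fun t : ℝ =>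
        homExt h ((x : Euc n) + t • (v : Euc n)) ^ (1 - α) - B * M ^ (1 - α) * t)
        (fderiv ℝ (homExt h) ((x : Euc n) + t • (v : Euc n)) v * (1 - α)
          * homExt h ((x : Euc n) + t • (v : Euc n)) ^ (1 - α - 1) - B * M ^ (1 - α) * 1) t :=
      fun t ht => ((hH.hasDerivAt_line (hne t ht)).rpow_const (Or.inl (hGpos t ht).ne')).fun_sub
        ((hasDerivAt_id' t).const_mul _)
    refine antitoneOn_of_deriv_nonpos (convex_Ici 0)
      (fun t ht => (hd t ht).continuousAt.continuousWithinAt)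
      (fun t ht => (hd t (interior_subset ht)).differentiableAt.differentiableWithinAt) fun t ht => ?_
    have ht0 : 0 ≤ t := interior_subset ht
    rw [(hd t ht0).deriv]
    have hG := hGpos t ht0
    set G := homExt h ((x : Euc n) + t • (v : Euc n))
    have h1 : G ^ α * G ^ (1 - α - 1) = 1 := by
      rw [← Real.rpow_add hG]
      norm_num
    have h2 : 0 < G ^ (1 - α - 1) := Real.rpow_pos_of_pos hG _
    have h3 : 0 < B * M ^ (1 - α) := by positivity
    calc fderiv ℝ (homExt h) ((x : Euc n) + t • (v : Euc n)) v * (1 - α) * G ^ (1 - α - 1)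
          - B * M ^ (1 - α) * 1
        ≤ B * M ^ (1 - α) * G ^ α * (1 - α) * G ^ (1 - α - 1) - B * M ^ (1 - α) * 1 := by
          gcongr
          exact hderiv t ht0
      _ = B * M ^ (1 - α) * (1 - α) * (G ^ α * G ^ (1 - α - 1)) - B * M ^ (1 - α) * 1 := by ring
      _ = -(α * (B * M ^ (1 - α))) := by rw [h1]; ring
      _ ≤ 0 := by
          have : 0 ≤ α * (B * M ^ (1 - α)) := by positivity
          linarith
  have h1 := hanti Set.self_mem_Ici ht₀pos.le ht₀pos.le
  simp only [zero_smul, add_zero, mul_zero, sub_zero, homExt_coe] at h1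
  have h2 : M * t₀ ≤ homExt h ((x : Euc n) + t₀ • (v : Euc n)) := by
    have h3 : t₀ ≤ ⟪(x : Euc n) + t₀ • (v : Euc n), (v : Euc n)⟫ := by
      rw [inner_add_left, real_inner_smul_left, real_inner_self_eq_norm_sq, norm_coe]
      linarith
    exact (mul_le_mul_of_nonneg_left h3 hMpos.le).trans
      (mul_inner_le_homExt hh hconv hv (ht₀pos.le.trans h3))
  have h4 : (M * t₀) ^ (1 - α) ≤ homExt h ((x : Euc n) + t₀ • (v : Euc n)) ^ (1 - α) := by
    gcongr
  have h5 : B * M ^ (1 - α) * t₀ = (M * t₀) ^ (1 - α) / 2 := by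
    have h6 : t₀ = t₀ ^ (1 - α) * t₀ ^ α := by
      rw [← Real.rpow_add ht₀pos, sub_add_cancel, Real.rpow_one]
    rw [Real.mul_rpow hMpos.le ht₀pos.le]
    nth_rewrite 1 [h6]
    rw [ht₀α]
    field_simp
  have h7 : (4 : ℝ) ^ (-(1 - α)) ≤ 1 / 2 := by
    have h8 : (4 : ℝ) ^ (-(1 - α)) ≤ 4 ^ (-(1 / 2) : ℝ) := by
      gcongr
      · norm_num
      · linarith
    have h9 : (4 : ℝ) ^ (-(1 / 2) : ℝ) = 1 / 2 := by
      rw [show (4 : ℝ) = 2 ^ (2 : ℝ) by norm_num, ← Real.rpow_mul (by norm_num)]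
      norm_num
    linarith
  have h10 : (t₀ / 4 * M) ^ (1 - α) ≤ h x ^ (1 - α) := by
    have h11 : (t₀ / 4 * M) ^ (1 - α) = (M * t₀) ^ (1 - α) * 4 ^ (-(1 - α)) := by
      rw [Real.rpow_neg (by norm_num), ← div_eq_mul_inv, ← Real.div_rpow (by positivity)
        (by norm_num)]
      congr 1
      ring
    have h12 : (M * t₀) ^ (1 - α) * 4 ^ (-(1 - α)) ≤ (M * t₀) ^ (1 - α) * (1 / 2) := by gcongr
    linarith
  exact (Real.rpow_le_rpow_iff (by positivity) (hhp x).le h1α).1 h10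

end Estimates

theorem rpow_inv_le_of_le_rpow {c M r δ : ℝ} (hc0 : 0 < c) (hc1 : c ≤ 1) (hM : 0 < M)
    (hδ : 0 < δ) (hr : δ ≤ r) (h : c ≤ M ^ r) : c ^ (1 / δ) ≤ M := by
  by_contra hcon
  push Not at hcon
  have h1 : M ≤ 1 := hcon.le.trans (Real.rpow_le_one hc0.le hc1 (by positivity))
  have h2 : M ^ r ≤ M ^ δ := Real.rpow_le_rpow_of_exponent_ge hM h1 hr
  have h3 : M ^ δ < (c ^ (1 / δ)) ^ δ := Real.rpow_lt_rpow hM.le hcon hδ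
  rw [← Real.rpow_mul hc0.le, one_div_mul_cancel hδ.ne', Real.rpow_one] at h3
  linarith

theorem le_rpow_inv_of_rpow_le {N μ r δ : ℝ} (hN : 1 ≤ N) (hδ : 0 < δ) (hr : δ ≤ r)
    (h : μ ^ r ≤ N) : μ ≤ N ^ (1 / δ) := by
  by_contra hcon
  push Not at hcon
  have h0 : 0 ≤ N := by linarith
  have h1 : 1 ≤ μ := (Real.one_le_rpow hN (by positivity)).trans hcon.le
  have h2 : μ ^ δ ≤ μ ^ r := Real.rpow_le_rpow_of_exponent_le h1 hr
  have h3 : (N ^ (1 / δ)) ^ δ < μ ^ δ := Real.rpow_lt_rpow (Real.rpow_nonneg h0 _) hcon hδ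
  rw [← Real.rpow_mul h0, one_div_mul_cancel hδ.ne', Real.rpow_one] at h3
  linarith

end ChristoffelMinkowski

open ChristoffelMinkowski in
theorem lemma3p3 (n k : ℕ) (hk : 1 ≤ k) (hkn : k ≤ n)
    (γ δ m A : ℝ) (hγ : 0 < γ) (hδ : 0 < δ) (hm : 0 < m) :
    ∃ C : ℝ, 0 < C ∧
      ∀ p q : ℝ, 1 < p → p < q → q ≤ (k : ℝ) + 1 →
        γ < 2 * (p - 1) / k → δ ≤ q - p →
      ∀ f : Sph n → ℝ, ContMDiff (𝓡 n) 𝓘(ℝ, ℝ) 2 f → (∀ x, m ≤ f x) → c2Norm f ≤ A →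
      ∀ h : Sph n → ℝ, ContMDiff (𝓡 n) 𝓘(ℝ, ℝ) ∞ h → (∀ x, h (-x) = h x) →
        StrictlyConvex h → IsSolution k p q f h →
        ∀ x : Sph n, 1 / C ≤ h x ∧ h x ≤ C ∧ ‖sphGrad h x‖ ≤ C := by
  have hk0 : (0 : ℝ) < k := by exact_mod_cast hk
  -- the hypotheses on `p` and `f` force `γ < 2` and `0 < A`, so other parameters are vacuous
  by_cases hadm : γ < 2 ∧ 0 < A
  swap
  · refine ⟨1, one_pos, fun p q hp hpq hq hγp hδq f hf hfm hfA h hh heven hconv hsol x =>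
      absurd ⟨?_, ?_⟩ hadm⟩
    · refine hγp.trans ?_
      rw [div_lt_iff₀ hk0]
      linarith
    · have h1 := (abs_le_and_norm_sphGrad_le_of_c2Norm_le (hf.of_le (by norm_num)) hfA x).1
      linarith [hfm x, le_abs_self (f x)]
  obtain ⟨hγ2, hA⟩ := hadm
  -- working with `γ / 2` instead of `γ` keeps `(p - 1) - k α` away from zero uniformly in `p`
  set α := γ / 4 with hα
  have hα0 : 0 < α := by positivity
  have hα1 : α ≤ 1 / 2 := by linarith
  have h1α : 0 < 1 - α := by linarith
  have hchoose : (0 : ℝ) < n.choose k := by exact_mod_cast Nat.choose_pos hkn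
  set C₁ := 1 / (α * (1 - α)) + A / (m * k * α) with hC₁
  have hC₁0 : 0 < C₁ := by positivity
  set c := (1 / (2 * (C₁ + 1))) ^ (1 / α) / 4 with hc
  have hc0 : 0 < c := by positivity
  set M₀ := (min 1 (m / n.choose k)) ^ (1 / δ) with hM₀
  have hmin : 0 < min 1 (m / (n.choose k : ℝ)) := lt_min one_pos (by positivity)
  have hM₀0 : 0 < M₀ := Real.rpow_pos_of_pos hmin _
  set N₀ := (max 1 A) ^ (1 / δ) with hN₀
  have hN₀0 : 0 < N₀ := Real.rpow_pos_of_pos (lt_max_of_lt_left one_pos) _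
  have hb1 : 0 < 1 / (c * M₀) := by positivity
  have hb2 : 0 < N₀ / c := by positivity
  have hb3 : 0 < C₁ * (N₀ / c) := by positivity
  refine ⟨1 / (c * M₀) + N₀ / c + C₁ * (N₀ / c), by positivity, ?_⟩
  intro p q hp hpq hq hγp hδq f hf hfm hfA h hh heven hconv hsol x
  have hn : 1 ≤ n := hk.trans hkn
  have hhp := pos_of_strictlyConvex hh hn heven hconv
  have hfA' := abs_le_and_norm_sphGrad_le_of_c2Norm_le (hf.of_le (by norm_num)) hfA
  have hpα : 2 * α * k ≤ p - 1 := by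
    rw [lt_div_iff₀ hk0] at hγp
    rw [hα]
    linarith
  have : Nonempty (Sph n) := ⟨x⟩
  obtain ⟨v, -, hv⟩ := isCompact_univ.exists_isMaxOn Set.univ_nonempty hh.continuous.continuousOn
  obtain ⟨z, -, hz⟩ := isCompact_univ.exists_isMinOn Set.univ_nonempty hh.continuous.continuousOn
  replace hv : ∀ y, h y ≤ h v := fun y => hv (Set.mem_univ y)
  replace hz : ∀ y, h z ≤ h y := fun y => hz (Set.mem_univ y)
  have hgrad := norm_sphGrad_le hh heven hconv hk hkn hα0 (by linarith) hm hA.le hpα hq hf hfm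
    (fun y => (hfA' y).2) hsol hv
  have hcM : c * h v ≤ h z := mul_max_le_min hh hn heven hconv hα0 hα1 hC₁0.le hv hgrad
  have hMlow : M₀ ≤ h v := by
    refine rpow_inv_le_of_le_rpow hmin (min_le_left _ _) (hhp v) hδ hδq ((min_le_right _ _).trans ?_)
    rw [div_le_iff₀ hchoose, mul_comm]
    exact le_choose_mul_of_isMax hh hconv hfm hsol (hhp v) hv
  have hzup : h z ≤ N₀ := by
    refine le_rpow_inv_of_rpow_le (le_max_left _ _) hδ hδq (le_trans ?_ (le_max_right _ _))
    refine le_trans ?_ (choose_mul_le_of_isMin hh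
      (fun y => (le_abs_self _).trans (hfA' y).1) hsol (hhp z) hz)
    refine le_mul_of_one_le_left (Real.rpow_nonneg (hhp z).le _) ?_
    exact_mod_cast Nat.choose_pos hkn
  have hMup : h v ≤ N₀ / c := by
    rw [le_div_iff₀ hc0]
    linarith
  refine ⟨?_, ?_, ?_⟩
  · have h1 : c * M₀ ≤ h x := (mul_le_mul_of_nonneg_left hMlow hc0.le).trans (hcM.trans (hz x))
    refine le_trans ?_ h1
    rw [div_le_iff₀ (by positivity)]
    have h2 : c * M₀ * (1 / (c * M₀)) = 1 := mul_one_div_cancel (by positivity)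
    have h3 : 0 < c * M₀ := by positivity
    nlinarith
  · linarith [hv x]
  · have h1 : h v ^ (1 - α) * h x ^ α ≤ h v := by
      calc h v ^ (1 - α) * h x ^ α ≤ h v ^ (1 - α) * h v ^ α := by
            gcongr
            · exact Real.rpow_nonneg (hhp v).le _
            · exact (hhp x).le
            · exact hv x
        _ = h v := by rw [← Real.rpow_add (hhp v), sub_add_cancel, Real.rpow_one]
    have h2 : ‖sphGrad h x‖ ≤ C₁ * h v := by
      refine (hgrad x).trans ?_
      rw [mul_assoc]
      exact mul_le_mul_of_nonneg_left h1 hC₁0.le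
    have h3 : C₁ * h v ≤ C₁ * (N₀ / c) := mul_le_mul_of_nonneg_left hMup hC₁0.le
    linarith
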